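/- Let $H$ be a discrete non-amenable group, $\mathbb Z_2=\{0,1\}$ and $G=\mathbb Z_2\times H$. Let $X=\{x_{ij}\}_{i,j\in\mathbb N}$, $Y=\{y_i\}_{i\in\mathbb N}$, $Z=\{z_i\}_{i\in\mathbb N}$ be countably infinite sets with pairwise distinct elements and let $\epsilon$ be a further point. Let $\mathcal G$ be the bundle of groups $$\mathcal G = X\sqcup(\mathbb Z_2\times Y)\sqcup(G\times Z)\sqcup(G\times\{\epsilon\}),\qquad \mathcal G^{(0)}=X\sqcup Y\sqcup Z\sqcup\{\epsilon\},$$ with trivial isotropy over $X$, with $s(g,u)=r(g,u)=u$ and $(g,u)(g',u)=(gg',u)$ elsewhere, and with $y\in Y$ and $u\in Z\sqcup\{\epsilon\}$ identified with the units $(0,y)$ and $(0,1_H,u)$. Write $X_i=\{x_{ij}:j\in\mathbb N\}$. The topology of $\mathcal G$ has as a basis of open sets the singletons $\{x\}$ $(x\in X)$ and $\{(g,z)\}$ $(g\in G, z\in Z)$, the sets $\{(n,y_i)\}\cup (X_i\setminus E)$ with $n\in\mathbb Z_2$, $i\in\mathbb N$, $E\subset X_i$ finite, and the sets $$\{(g,\epsilon)\}\cup\{(g,z_i):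 i\notin E'\}\cup\{(n,y_i): i\notin E\}\cup\bigcup_{i\notin E}X_i$$ with $g=(n,h)\in G$ and $E,E'\subset\mathbb N$ finite. Then $\mathcal G$ is a (non-Hausdorff) étale groupoid. Put $$V=X\sqcup Y,\qquad F=Z\sqcup\{\epsilon\},$$ an open and a closed subset partitioning $\mathcal G^{(0)}$, and $\mathcal G_V=V\mathcal GV$, $\mathcal G_F=F\mathcal GF$ with the subspace topologies. Put also $B=X\sqcup Y$, regarded as a set of units in $\mathcal G$. For an étale groupoid $\mathcal H$ with locally compact Hausdorff unit space, let $\mathcal A(\mathcal H)$ be the span of the functions in $C_c(U)$, extended by zero to $\mathcal H$, where $U$ ranges over the open bisections. For a unit $w$ let $\lambda_w$ be the regular representation on $\ell^2(\mathcal Hw)$, $\lambda_w(f)\delta_\gamma=\sum_{s(\alpha)=r(\gamma)}f(\alpha)\delta_{\alpha\gamma}$. The reduced C*-algebra $C^*_r(\mathcal H)$ is the completion of $\mathcal A(\mathcal H)$ for the norm $\sup_w\|\lambda_w(\cdot)\|$; its elements $a$ are regarded as functions on $\mathcal H$ by $a(\gamma)=\langle \delta_\gamma,\lambda_{s(\gamma)}(a)\delta_{s(\gamma)}\rangle$.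 Let $J_{\mathcal H}$ be the ideal of those $a\in C^*_r(\mathcal H)$ for which $\{\gamma: a(\gamma)\ne0\}$ has empty interior, and let $C^*_{\rm ess}(\mathcal H)=C^*_r(\mathcal H)/J_{\mathcal H}$. Extension of functions by zero induces $*$-homomorphisms $C^*_r(\mathcal G_V)\to C^*_r(\mathcal G)$ and $C^*_{\rm ess}(\mathcal G_V)\to C^*_{\rm ess}(\mathcal G)$. Restriction of functions to $\mathcal G_F$ induces a $*$-homomorphism $r_F\colon C^*_r(\mathcal G)\to C^*_r(\mathcal G_F)$, which vanishes on $J_{\mathcal G}$ and hence induces $r_F^{\rm ess}\colon C^*_{\rm ess}(\mathcal G)\to C^*_r(\mathcal G_F)$. Then neither of the sequences of $K_0$-groups induced by these maps, $$K_0(C^*_r(\mathcal G_V))\to K_0(C^*_r(\mathcal G))\to K_0(C^*_r(\mathcal G_F)),$$ $$K_0(C^*_{\rm ess}(\mathcal G_V))\to K_0(C^*_{\rm ess}(\mathcal G))\to K_0(C^*_r(\mathcal G_F)),$$ is exact in the middle. More precisely, the characteristic function $\chi_B$ is (the function of) a projection in $C^*_r(\mathcal G)$; its class $[\chi_B]_0$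 is mapped to $0$ in $K_0(C^*_r(\mathcal G_F))$ but is not in the image of $K_0(C^*_r(\mathcal G_V))$; and the class $[\chi_B+J_{\mathcal G}]_0\in K_0(C^*_{\rm ess}(\mathcal G))$ is mapped to $0$ in $K_0(C^*_r(\mathcal G_F))$ but is not in the image of $K_0(C^*_{\rm ess}(\mathcal G_V))$. -/

import Mathlib

open scoped Matrix
set_option linter.unusedSectionVars false

noncomputable section

/-! ### K-theory of star algebras -/

namespace KTheory

section Unital

variable {B C : Type*} [Ring B] [Ring C] {m n k l m' n' : ℕ}

/-- The block diagonal matrix `P ⊕ Q`. -/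
def dsum (P : Matrix (Fin m) (Fin n) B) (Q : Matrix (Fin k) (Fin l) B) :
    Matrix (Fin (m + k)) (Fin (n + l)) B :=
  (Matrix.fromBlocks P 0 0 Q).submatrix finSumFinEquiv.symm finSumFinEquiv.symm

theorem dsum_mul (P : Matrix (Fin m) (Fin n) B) (P' : Matrix (Fin n) (Fin m') B)
    (Q : Matrix (Fin k) (Fin l) B) (Q' : Matrix (Fin l) (Fin n') B) :
    dsum P Q * dsum P' Q' = dsum (P * P') (Q * Q') := by
  simp [dsum, Matrix.submatrix_mul_equiv, Matrix.fromBlocks_multiply]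

theorem dsum_comm (P : Matrix (Fin m) (Fin m) B) (Q : Matrix (Fin n) (Fin n) B) :
    ∃ e : Fin (m + n) ≃ Fin (n + m), dsum P Q = (dsum Q P).submatrix e e := by
  refine ⟨(finSumFinEquiv.symm.trans (Equiv.sumComm _ _)).trans finSumFinEquiv, ?_⟩
  ext i j
  obtain ⟨i, rfl⟩ := finSumFinEquiv.surjective i
  obtain ⟨j, rfl⟩ := finSumFinEquiv.surjective j
  rcases i with i | i <;> rcases j with j | j <;> simp [dsum]

theorem dsum_assoc (P : Matrix (Fin m) (Fin m) B) (Q : Matrix (Fin n) (Fin n) B)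
    (R : Matrix (Fin k) (Fin k) B) :
    ∃ e : Fin (m + n + k) ≃ Fin (m + (n + k)),
      dsum (dsum P Q) R = (dsum P (dsum Q R)).submatrix e e := by
  refine ⟨(((finSumFinEquiv.symm.trans (Equiv.sumCongr finSumFinEquiv.symm (Equiv.refl _))).trans
    (Equiv.sumAssoc _ _ _)).trans (Equiv.sumCongr (Equiv.refl _) finSumFinEquiv)).trans
    finSumFinEquiv, ?_⟩
  ext i j
  obtain ⟨i, rfl⟩ := finSumFinEquiv.surjective i
  obtain ⟨j, rfl⟩ := finSumFinEquiv.surjective j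
  rcases i with i | i <;> rcases j with j | j
  · obtain ⟨i, rfl⟩ := finSumFinEquiv.surjective i
    obtain ⟨j, rfl⟩ := finSumFinEquiv.surjective j
    rcases i with i | i <;> rcases j with j | j <;> simp [dsum]
  · obtain ⟨i, rfl⟩ := finSumFinEquiv.surjective i
    rcases i with i | i <;> simp [dsum]
  · obtain ⟨j, rfl⟩ := finSumFinEquiv.surjective j
    rcases j with j | j <;> simp [dsum]
  · simp [dsum]

theorem zero_dsum (P : Matrix (Fin n) (Fin n) B) :
    ∃ e : Fin (0 + n) ≃ Fin n,
      dsum (0 : Matrix (Fin 0) (Fin 0) B) P = P.submatrix e e := by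
  refine ⟨finSumFinEquiv.symm.trans (Equiv.emptySum (Fin 0) _), ?_⟩
  ext i j
  obtain ⟨i, rfl⟩ := finSumFinEquiv.surjective i
  obtain ⟨j, rfl⟩ := finSumFinEquiv.surjective j
  rcases i with i | i
  · exact i.elim0
  rcases j with j | j
  · exact j.elim0
  simp [dsum, -finSumFinEquiv_apply_right]

variable [StarRing B] [StarRing C]

theorem dsum_conjTranspose (P : Matrix (Fin m) (Fin n) B) (Q : Matrix (Fin k) (Fin l) B) :
    (dsum P Q)ᴴ = dsum Pᴴ Qᴴ := by
  simp [dsum, Matrix.conjTranspose_submatrix, Matrix.fromBlocks_conjTranspose]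

/-- Murray-von Neumann equivalence: `P = v v*` and `Q = v* v`. -/
def MatEquiv (P : Matrix (Fin m) (Fin m) B) (Q : Matrix (Fin n) (Fin n) B) : Prop :=
  ∃ v : Matrix (Fin m) (Fin n) B, v * vᴴ = P ∧ vᴴ * v = Q

theorem MatEquiv.symm {P : Matrix (Fin m) (Fin m) B} {Q : Matrix (Fin n) (Fin n) B}
    (h : MatEquiv P Q) : MatEquiv Q P := by
  obtain ⟨v, h₁, h₂⟩ := h
  exact ⟨vᴴ, by rwa [Matrix.conjTranspose_conjTranspose],
    by rwa [Matrix.conjTranspose_conjTranspose]⟩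

theorem MatEquiv.trans {P : Matrix (Fin m) (Fin m) B} {Q : Matrix (Fin n) (Fin n) B}
    {R : Matrix (Fin k) (Fin k) B} (hP : IsStarProjection P) (hR : IsStarProjection R)
    (h : MatEquiv P Q) (h' : MatEquiv Q R) : MatEquiv P R := by
  obtain ⟨v, h₁, h₂⟩ := h
  obtain ⟨w, h₃, h₄⟩ := h'
  refine ⟨v * w, ?_, ?_⟩
  · calc v * w * (v * w)ᴴ = v * (w * wᴴ) * vᴴ := by
          simp only [Matrix.conjTranspose_mul, Matrix.mul_assoc]
      _ = (v * vᴴ) * (v * vᴴ) := by rw [h₃, ← h₂]; simp only [Matrix.mul_assoc]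
      _ = P := by rw [h₁, hP.1.eq]
  · calc (v * w)ᴴ * (v * w) = wᴴ * (vᴴ * v) * w := by
          simp only [Matrix.conjTranspose_mul, Matrix.mul_assoc]
      _ = (wᴴ * w) * (wᴴ * w) := by rw [h₂, ← h₃]; simp only [Matrix.mul_assoc]
      _ = R := by rw [h₄, hR.1.eq]

theorem MatEquiv.dsum {P : Matrix (Fin m) (Fin m) B} {P' : Matrix (Fin m') (Fin m') B}
    {Q : Matrix (Fin n) (Fin n) B} {Q' : Matrix (Fin n') (Fin n') B}
    (h : MatEquiv P P') (h' : MatEquiv Q Q') :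
    MatEquiv (KTheory.dsum P Q) (KTheory.dsum P' Q') := by
  obtain ⟨v, h₁, h₂⟩ := h
  obtain ⟨w, h₃, h₄⟩ := h'
  exact ⟨KTheory.dsum v w, by rw [dsum_conjTranspose, dsum_mul, h₁, h₃],
    by rw [dsum_conjTranspose, dsum_mul, h₂, h₄]⟩

theorem MatEquiv.of_equiv {P : Matrix (Fin m) (Fin m) B} {Q : Matrix (Fin n) (Fin n) B}
    (hQ : IsStarProjection Q) (e : Fin m ≃ Fin n)
    (h : P = Q.submatrix e e) : MatEquiv P Q := by
  have hs : Qᴴ = Q := hQ.2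
  have hm : Q * Q = Q := hQ.1
  refine ⟨Q.submatrix e id, ?_, ?_⟩
  · rw [Matrix.conjTranspose_submatrix, hs, h]
    exact (Matrix.submatrix_mul_equiv Q Q e (Equiv.refl _) e).trans (by rw [hm])
  · rw [Matrix.conjTranspose_submatrix, hs, Matrix.submatrix_mul_equiv, hm,
      Matrix.submatrix_id_id]

theorem dsum_isStarProjection {P : Matrix (Fin m) (Fin m) B} {Q : Matrix (Fin n) (Fin n) B}
    (hP : IsStarProjection P) (hQ : IsStarProjection Q) : IsStarProjection (dsum P Q) := by
  constructor
  · rw [IsIdempotentElem, dsum_mul, hP.1.eq, hQ.1.eq]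
  · rw [IsSelfAdjoint, Matrix.star_eq_conjTranspose, dsum_conjTranspose,
      ← Matrix.star_eq_conjTranspose, ← Matrix.star_eq_conjTranspose, hP.2.star_eq, hQ.2.star_eq]

/-- Projections (self-adjoint idempotents) in the square matrices of all sizes over `B`. -/
structure ProjMat (B : Type*) [Ring B] [StarRing B] where
  /-- the size of the matrix -/
  size : ℕ
  /-- the matrix -/
  mat : Matrix (Fin size) (Fin size) B
  isProj : IsStarProjection mat

/-- Murray-von Neumann equivalence of projections in matrices over `B`. -/
instance ProjMat.setoid (B : Type*) [Ring B] [StarRing B] : Setoid (ProjMat B) where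
  r p q := MatEquiv p.mat q.mat
  iseqv :=
    { refl := fun p => MatEquiv.of_equiv p.isProj (Equiv.refl _) rfl
      symm := fun h => h.symm
      trans := fun {p _ r} h h' => MatEquiv.trans p.isProj r.isProj h h' }

/-- The Murray-von Neumann semigroup of `B`: classes of projections in matrices over `B`, with the
addition given by block diagonal sums. -/
def MvNSemigroup (B : Type*) [Ring B] [StarRing B] : Type _ := Quotient (ProjMat.setoid B)

namespace MvNSemigroup

/-- The class of a projection. -/
def mk (P : Matrix (Fin n) (Fin n) B) (hP : IsStarProjection P) : MvNSemigroup B :=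
  Quotient.mk _ ⟨n, P, hP⟩

theorem sound {P : Matrix (Fin m) (Fin m) B} {hP : IsStarProjection P}
    {Q : Matrix (Fin n) (Fin n) B} {hQ : IsStarProjection Q} (h : MatEquiv P Q) :
    mk P hP = mk Q hQ := Quotient.sound h

theorem zero_isStarProjection : IsStarProjection (0 : Matrix (Fin n) (Fin n) B) := by
  constructor <;> simp [IsIdempotentElem, IsSelfAdjoint]

instance : Zero (MvNSemigroup B) := ⟨mk (0 : Matrix (Fin 0) (Fin 0) B) zero_isStarProjection⟩

instance : Add (MvNSemigroup B) :=
  ⟨Quotient.map₂ (fun p q => ⟨p.size + q.size, dsum p.mat q.mat,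
    dsum_isStarProjection p.isProj q.isProj⟩) fun _ _ h _ _ h' => h.dsum h'⟩

theorem mk_add_mk {P : Matrix (Fin m) (Fin m) B} (hP : IsStarProjection P)
    {Q : Matrix (Fin n) (Fin n) B} (hQ : IsStarProjection Q) :
    mk P hP + mk Q hQ = mk (dsum P Q) (dsum_isStarProjection hP hQ) := rfl

theorem exists_rep (a : MvNSemigroup B) :
    ∃ (n : ℕ) (P : Matrix (Fin n) (Fin n) B) (hP : IsStarProjection P), a = mk P hP := by
  induction a using Quotient.inductionOn with | _ p
  exact ⟨p.size, p.mat, p.isProj, rfl⟩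

protected theorem add_comm (a b : MvNSemigroup B) : a + b = b + a := by
  obtain ⟨m, P, hP, rfl⟩ := exists_rep a
  obtain ⟨n, Q, hQ, rfl⟩ := exists_rep b
  obtain ⟨e, he⟩ := dsum_comm P Q
  exact sound (MatEquiv.of_equiv (dsum_isStarProjection hQ hP) e he)

protected theorem zero_add (a : MvNSemigroup B) : 0 + a = a := by
  obtain ⟨n, P, hP, rfl⟩ := exists_rep a
  obtain ⟨e, he⟩ := zero_dsum P
  exact sound (MatEquiv.of_equiv hP e he)

instance : AddCommMonoid (MvNSemigroup B) where
  add_assoc a b c := by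
    obtain ⟨m, P, hP, rfl⟩ := exists_rep a
    obtain ⟨n, Q, hQ, rfl⟩ := exists_rep b
    obtain ⟨k, R, hR, rfl⟩ := exists_rep c
    obtain ⟨e, he⟩ := dsum_assoc P Q R
    exact sound (MatEquiv.of_equiv
      (dsum_isStarProjection hP (dsum_isStarProjection hQ hR)) e he)
  zero_add := MvNSemigroup.zero_add
  add_zero a := by rw [MvNSemigroup.add_comm, MvNSemigroup.zero_add]
  add_comm := MvNSemigroup.add_comm
  nsmul := nsmulRec

variable [Algebra ℂ B] [Algebra ℂ C]

theorem map_isStarProjection (φ : B →⋆ₐ[ℂ] C) {P : Matrix (Fin n) (Fin n) B}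
    (hP : IsStarProjection P) : IsStarProjection (P.map φ) := by
  constructor
  · rw [IsIdempotentElem, ← Matrix.map_mul, hP.1.eq]
  · rw [IsSelfAdjoint, Matrix.star_eq_conjTranspose, ← Matrix.conjTranspose_map _ (map_star φ),
      ← Matrix.star_eq_conjTranspose, hP.2.star_eq]

theorem map_matEquiv (φ : B →⋆ₐ[ℂ] C) {P : Matrix (Fin m) (Fin m) B}
    {Q : Matrix (Fin n) (Fin n) B} (h : MatEquiv P Q) : MatEquiv (P.map φ) (Q.map φ) := by
  obtain ⟨v, h₁, h₂⟩ := h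
  refine ⟨v.map φ, ?_, ?_⟩
  · rw [← Matrix.conjTranspose_map _ (map_star φ), ← Matrix.map_mul, h₁]
  · rw [← Matrix.conjTranspose_map _ (map_star φ), ← Matrix.map_mul, h₂]

/-- The map of Murray-von Neumann semigroups given by the entrywise application of a unital
star homomorphism. -/
def map (φ : B →⋆ₐ[ℂ] C) : MvNSemigroup B →+ MvNSemigroup C where
  toFun := Quotient.map (fun p => ⟨p.size, p.mat.map φ, map_isStarProjection φ p.isProj⟩)
    fun _ _ h => map_matEquiv φ h
  map_zero' := sound (MatEquiv.of_equiv zero_isStarProjection (Equiv.refl _)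
    (by ext i; exact i.elim0))
  map_add' a b := by
    obtain ⟨m, P, hP, rfl⟩ := exists_rep a
    obtain ⟨n, Q, hQ, rfl⟩ := exists_rep b
    refine sound (MatEquiv.of_equiv (dsum_isStarProjection
      (map_isStarProjection φ hP) (map_isStarProjection φ hQ)) (Equiv.refl _) ?_)
    change (dsum P Q).map φ = dsum (P.map φ) (Q.map φ)
    ext i j
    obtain ⟨i, rfl⟩ := finSumFinEquiv.surjective i
    obtain ⟨j, rfl⟩ := finSumFinEquiv.surjective j
    rcases i with i | i <;> rcases j with j | j <;> simp [dsum]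

end MvNSemigroup

/-- For a unital `B`, the Grothendieck group of the Murray-von Neumann semigroup. -/
abbrev K00 (B : Type*) [Ring B] [StarRing B] : Type _ :=
  Algebra.GrothendieckAddGroup (MvNSemigroup B)

/-- The class in `K00 B` of a projection in `B`, seen as a matrix of size one. -/
def K00.mk (p : B) (hp : IsStarProjection p) : K00 B :=
  Algebra.GrothendieckAddGroup.of (MvNSemigroup.mk
    (Matrix.of fun _ _ => p : Matrix (Fin 1) (Fin 1) B)
    ⟨by ext i j; simp [Matrix.mul_apply, hp.1.eq], by ext i j; simp [Matrix.star_apply, hp.2.star_eq]⟩)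

/-- The homomorphism on `K00` induced by a unital star homomorphism. -/
def K00.map [Algebra ℂ B] [Algebra ℂ C] (φ : B →⋆ₐ[ℂ] C) : K00 B →+ K00 C :=
  Algebra.GrothendieckAddGroup.lift (Algebra.GrothendieckAddGroup.of.comp (MvNSemigroup.map φ))

theorem K00.map_of [Algebra ℂ B] [Algebra ℂ C] (φ : B →⋆ₐ[ℂ] C) (a : MvNSemigroup B) :
    K00.map φ (Algebra.GrothendieckAddGroup.of a)
      = Algebra.GrothendieckAddGroup.of (MvNSemigroup.map φ a) :=
  DFunLike.congr_fun (Algebra.GrothendieckAddGroup.lift.symm_apply_apply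
    (Algebra.GrothendieckAddGroup.of.comp (MvNSemigroup.map φ))) a

theorem K00.map_comp_apply {D : Type*} [Ring D] [StarRing D] [Algebra ℂ B] [Algebra ℂ C]
    [Algebra ℂ D] (ψ : C →⋆ₐ[ℂ] D) (φ : B →⋆ₐ[ℂ] C) (a : K00 B) :
    K00.map ψ (K00.map φ a) = K00.map (ψ.comp φ) a := by
  suffices h : (K00.map ψ).comp (K00.map φ) = K00.map (ψ.comp φ) from DFunLike.congr_fun h a
  refine Algebra.GrothendieckAddGroup.lift.symm.injective ?_
  ext a
  obtain ⟨m, P, hP, rfl⟩ := MvNSemigroup.exists_rep a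
  simp only [Algebra.GrothendieckAddGroup.lift_symm_apply, AddMonoidHom.comp_apply, K00.map_of]
  rfl

end Unital

section NonUnital

variable {A : Type*} [NonUnitalRing A] [StarRing A] [Module ℂ A] [IsScalarTower ℂ A A]
  [SMulCommClass ℂ A A] [StarModule ℂ A]
variable {A' : Type*} [NonUnitalRing A'] [StarRing A'] [Module ℂ A'] [IsScalarTower ℂ A' A']
  [SMulCommClass ℂ A' A'] [StarModule ℂ A']

/-- The quotient map `A⁺ → ℂ` of the unitization `A⁺` of `A`. -/
def scalarPart (A : Type*) [NonUnitalRing A] [StarRing A] [Module ℂ A] [IsScalarTower ℂ A A]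
    [SMulCommClass ℂ A A] [StarModule ℂ A] : Unitization ℂ A →⋆ₐ[ℂ] ℂ :=
  { Unitization.fstHom ℂ A with map_star' := fun _ => rfl }

theorem scalarPart_inr (a : A) : scalarPart A (Unitization.inr a) = 0 := rfl

/-- `K₀(A) = ker (K₀₀(A⁺) → K₀₀(ℂ))`, for a star algebra `A` that need not be unital. -/
def K₀ (A : Type*) [NonUnitalRing A] [StarRing A] [Module ℂ A] [IsScalarTower ℂ A A]
    [SMulCommClass ℂ A A] [StarModule ℂ A] : AddSubgroup (K00 (Unitization ℂ A)) :=
  (K00.map (scalarPart A)).ker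

/-- The homomorphism `K₀(φ)` for a star homomorphism `φ`, which need not be unital. -/
def K₀.map (φ : A →⋆ₙₐ[ℂ] A') : K₀ A →+ K₀ A' :=
  ((K00.map (Unitization.starMap φ)).comp (K₀ A).subtype).codRestrict (K₀ A') fun a => by
    have h : (scalarPart A').comp (Unitization.starMap φ) = scalarPart A := by
      ext <;> simp [scalarPart_inr]
    have ha : K00.map (scalarPart A) a = 0 := a.2
    change K00.map (scalarPart A') (K00.map (Unitization.starMap φ) a) = 0
    rw [K00.map_comp_apply, h, ha]

/-- The class `[p]₀ ∈ K₀(A)` of a projection `p ∈ A`. -/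
def K₀.mk (p : A) (hp : IsStarProjection p) : K₀ A :=
  ⟨K00.mk (Unitization.inr p) ⟨by rw [IsIdempotentElem, ← Unitization.inr_mul, hp.1.eq],
    by rw [IsSelfAdjoint, ← Unitization.inr_star, hp.2.star_eq]⟩, by
    change K00.map (scalarPart A) (Algebra.GrothendieckAddGroup.of _) = 0
    rw [K00.map_of, ← map_zero Algebra.GrothendieckAddGroup.of]
    congr 1
    refine MvNSemigroup.sound ⟨0, ?_, ?_⟩
    · ext i j
      simp [scalarPart_inr]
    · simp⟩

end NonUnital

end KTheory

/-! ### Quotients of star algebras and operators on `ℓ²` -/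

section StarIdeal

/-- A two-sided ideal of a star algebra that is closed under the involution. -/
structure StarIdeal (A : Type*) [NonUnitalRing A] [StarRing A] [Module ℂ A] extends
    Submodule ℂ A where
  mul_left_mem : ∀ a b, b ∈ carrier → a * b ∈ carrier
  mul_right_mem : ∀ a b, a ∈ carrier → a * b ∈ carrier
  star_mem' : ∀ a, a ∈ carrier → star a ∈ carrier

namespace StarIdeal

variable {A : Type*} [NonUnitalRing A] [StarRing A] [Module ℂ A]
variable {B : Type*} [NonUnitalRing B] [StarRing B] [Module ℂ B]

/-- The quotient star algebra `A / J`. -/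
def Quot (J : StarIdeal A) : Type _ := A ⧸ J.toSubmodule

variable (J : StarIdeal A)

instance : AddCommGroup J.Quot := inferInstanceAs (AddCommGroup (A ⧸ J.toSubmodule))

instance : Module ℂ J.Quot := inferInstanceAs (Module ℂ (A ⧸ J.toSubmodule))

/-- The class of an element in the quotient. -/
def toQuot : A →ₗ[ℂ] J.Quot := J.toSubmodule.mkQ

variable {J}

theorem toQuot_surjective : Function.Surjective J.toQuot := Submodule.mkQ_surjective _

theorem toQuot_eq {a b : A} : J.toQuot a = J.toQuot b ↔ a - b ∈ J.toSubmodule :=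
  Submodule.Quotient.eq _

variable (J)

instance : Mul J.Quot where
  mul := Quotient.map₂ (· * ·) fun a a' h b b' h' => by
    have h₁ : a - a' ∈ J.toSubmodule := (Submodule.quotientRel_def _).1 h
    have h₂ : b - b' ∈ J.toSubmodule := (Submodule.quotientRel_def _).1 h'
    refine (Submodule.quotientRel_def _).2 ?_
    have : a * b - a' * b' = (a - a') * b + a' * (b - b') := by
      rw [sub_mul, mul_sub]; abel
    rw [this]
    exact J.toSubmodule.add_mem (J.mul_right_mem _ _ h₁) (J.mul_left_mem _ _ h₂)

instance : Star J.Quot where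
  star := Quotient.map star fun a a' h => by
    have h₁ : a - a' ∈ J.toSubmodule := (Submodule.quotientRel_def _).1 h
    refine (Submodule.quotientRel_def _).2 ?_
    rw [← star_sub]
    exact J.star_mem' _ h₁

variable {J}

theorem toQuot_mul (a b : A) : J.toQuot (a * b) = J.toQuot a * J.toQuot b := rfl

theorem toQuot_star (a : A) : J.toQuot (star a) = star (J.toQuot a) := rfl

variable (J)

instance : NonUnitalRing J.Quot where
  __ := (inferInstance : AddCommGroup J.Quot)
  __ := (inferInstance : Mul J.Quot)
  left_distrib a b c := by
    obtain ⟨a, rfl⟩ := toQuot_surjective a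
    obtain ⟨b, rfl⟩ := toQuot_surjective b
    obtain ⟨c, rfl⟩ := toQuot_surjective c
    simp only [← map_add, ← toQuot_mul, mul_add]
  right_distrib a b c := by
    obtain ⟨a, rfl⟩ := toQuot_surjective a
    obtain ⟨b, rfl⟩ := toQuot_surjective b
    obtain ⟨c, rfl⟩ := toQuot_surjective c
    simp only [← map_add, ← toQuot_mul, add_mul]
  zero_mul a := by
    obtain ⟨a, rfl⟩ := toQuot_surjective a
    rw [← map_zero J.toQuot, ← toQuot_mul, zero_mul]
  mul_zero a := by
    obtain ⟨a, rfl⟩ := toQuot_surjective a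
    rw [← map_zero J.toQuot, ← toQuot_mul, mul_zero]
  mul_assoc a b c := by
    obtain ⟨a, rfl⟩ := toQuot_surjective a
    obtain ⟨b, rfl⟩ := toQuot_surjective b
    obtain ⟨c, rfl⟩ := toQuot_surjective c
    simp only [← toQuot_mul, mul_assoc]

instance : StarRing J.Quot where
  star_involutive a := by
    obtain ⟨a, rfl⟩ := toQuot_surjective a
    simp only [← toQuot_star, star_star]
  star_mul a b := by
    obtain ⟨a, rfl⟩ := toQuot_surjective a
    obtain ⟨b, rfl⟩ := toQuot_surjective b
    simp only [← toQuot_star, ← toQuot_mul, star_mul]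
  star_add a b := by
    obtain ⟨a, rfl⟩ := toQuot_surjective a
    obtain ⟨b, rfl⟩ := toQuot_surjective b
    simp only [← toQuot_star, ← map_add, star_add]

instance [IsScalarTower ℂ A A] : IsScalarTower ℂ J.Quot J.Quot where
  smul_assoc r a b := by
    obtain ⟨a, rfl⟩ := toQuot_surjective a
    obtain ⟨b, rfl⟩ := toQuot_surjective b
    simp only [smul_eq_mul, ← map_smul, ← toQuot_mul, smul_mul_assoc]

instance [SMulCommClass ℂ A A] : SMulCommClass ℂ J.Quot J.Quot where
  smul_comm r a b := by
    obtain ⟨a, rfl⟩ := toQuot_surjective a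
    obtain ⟨b, rfl⟩ := toQuot_surjective b
    simp only [smul_eq_mul, ← map_smul, ← toQuot_mul, mul_smul_comm]

instance [StarModule ℂ A] : StarModule ℂ J.Quot where
  star_smul r a := by
    obtain ⟨a, rfl⟩ := toQuot_surjective a
    simp only [← map_smul, ← toQuot_star, star_smul]

/-- The quotient map, as a star homomorphism. -/
def quotHom : A →⋆ₙₐ[ℂ] J.Quot where
  toFun := J.toQuot
  map_smul' := map_smul J.toQuot
  map_zero' := map_zero J.toQuot
  map_add' := map_add J.toQuot
  map_mul' := toQuot_mul
  map_star' := toQuot_star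

/-- The star homomorphism on `A / J` induced by one on `A` that vanishes on `J`. -/
def lift (φ : A →⋆ₙₐ[ℂ] B) (h : ∀ a ∈ J.toSubmodule, φ a = 0) : J.Quot →⋆ₙₐ[ℂ] B :=
  let ψ : J.Quot →ₗ[ℂ] B := J.toSubmodule.liftQ
    { toFun := φ, map_add' := map_add φ, map_smul' := map_smul φ } h
  have hψ : ∀ a, ψ (J.toQuot a) = φ a := fun _ => rfl
  { toFun := ψ
    map_smul' := map_smul ψ
    map_zero' := map_zero ψ
    map_add' := map_add ψ
    map_mul' := fun a b => by
      obtain ⟨a, rfl⟩ := toQuot_surjective a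
      obtain ⟨b, rfl⟩ := toQuot_surjective b
      rw [← toQuot_mul, hψ, hψ, hψ, map_mul]
    map_star' := fun a => by
      obtain ⟨a, rfl⟩ := toQuot_surjective a
      rw [← toQuot_star, hψ, hψ, map_star] }

theorem quotHom_isStarProjection {p : A} (hp : IsStarProjection p) :
    IsStarProjection (J.quotHom p) :=
  ⟨by rw [IsIdempotentElem, ← map_mul, hp.1.eq], by rw [IsSelfAdjoint, ← map_star, hp.2.star_eq]⟩

end StarIdeal

end StarIdeal

section Ell2

open Classical in
/-- The Hilbert space `ℓ²(ι)`. -/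
abbrev Ell2 (ι : Type*) : Type _ := lp (fun _ : ι => ℂ) 2

open Classical in
/-- The basis vector `δ_i` of `ℓ²(ι)`. -/
def delta {ι : Type*} (i : ι) : Ell2 ι := lp.single 2 i (1 : ℂ)

variable {ι κ : Type*}

open Classical in
theorem delta_apply (i j : ι) : (delta i : Ell2 ι) j = if j = i then 1 else 0 := by
  rw [delta, lp.coeFn_single, Pi.single_apply]

theorem inner_delta (i : ι) (x : Ell2 ι) : inner ℂ (delta i) x = x i := by
  classical
  rw [delta, lp.inner_single_left]; simp

theorem hasSum_delta (x : Ell2 ι) : HasSum (fun i => x i • delta i) x := by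
  classical
  have h := lp.hasSum_single (p := 2) (by simp) x
  have e : (fun i => x i • delta i) = fun i => lp.single 2 i (x i) := by
    funext i
    rw [delta, ← lp.single_smul, smul_eq_mul, mul_one]
  rwa [e]

theorem clm_ext {E : Type*} [NormedAddCommGroup E] [NormedSpace ℂ E] {S T : Ell2 ι →L[ℂ] E}
    (h : ∀ i, S (delta i) = T (delta i)) : S = T := by
  ext1 x
  have h₁ := (hasSum_delta x).mapL S
  have h₂ := (hasSum_delta x).mapL T
  simp only [map_smul, h] at h₁ h₂
  exact h₁.unique h₂

theorem clm_eq {S T : Ell2 ι →L[ℂ] Ell2 ι} (h : ∀ α β, S (delta β) α = T (delta β) α) : S = T :=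
  clm_ext fun β => by ext α; exact h α β

theorem orthonormal_delta : Orthonormal ℂ (delta : ι → Ell2 ι) := by
  classical
  rw [orthonormal_iff_ite]
  intro i j
  rw [inner_delta, delta_apply]

theorem orthonormal_delta_comp (φ : ι ↪ κ) : Orthonormal ℂ fun i => (delta (φ i) : Ell2 κ) :=
  orthonormal_delta.comp φ φ.injective

/-- The isometry `ℓ²(ι) → ℓ²(κ)` with `δ_i ↦ δ_{φ i}`. -/
def push (φ : ι ↪ κ) : Ell2 ι →L[ℂ] Ell2 κ :=
  (orthonormal_delta_comp φ).orthogonalFamily.linearIsometry.toContinuousLinearMap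

theorem push_delta (φ : ι ↪ κ) (i : ι) : push φ (delta i) = delta (φ i) := by
  classical
  simp [push, delta, OrthogonalFamily.linearIsometry_apply_single]

theorem push_adjoint_apply (φ : ι ↪ κ) (x : Ell2 κ) (i : ι) : (push φ).adjoint x i = x (φ i) := by
  rw [← inner_delta, ContinuousLinearMap.adjoint_inner_right, push_delta, inner_delta]

theorem adjoint_mul_push (φ : ι ↪ κ) : (push φ).adjoint ∘L push φ = 1 :=
  (ContinuousLinearMap.norm_map_iff_adjoint_comp_self _).1
    (orthonormal_delta_comp φ).orthogonalFamily.linearIsometry.norm_map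

theorem push_apply (φ : ι ↪ κ) (x : Ell2 ι) (i : ι) : push φ x (φ i) = x i := by
  rw [← push_adjoint_apply, ← ContinuousLinearMap.comp_apply, adjoint_mul_push]; rfl

theorem push_adjoint_delta (φ : ι ↪ κ) (i : ι) : (push φ).adjoint (delta (φ i)) = delta i := by
  rw [← push_delta, ← ContinuousLinearMap.comp_apply, adjoint_mul_push]; rfl

theorem push_adjoint_delta_of_notMem (φ : ι ↪ κ) {k : κ} (hk : k ∉ Set.range φ) :
    (push φ).adjoint (delta k) = 0 := by
  ext i
  rw [push_adjoint_apply, delta_apply, if_neg fun h => hk ⟨i, h⟩]; rfl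

theorem push_apply_of_notMem (φ : ι ↪ κ) {k : κ} (hk : k ∉ Set.range φ) (x : Ell2 ι) :
    push φ x k = 0 := by
  rw [← inner_delta, ← ContinuousLinearMap.adjoint_inner_left, push_adjoint_delta_of_notMem φ hk,
    inner_zero_left]

end Ell2

/-! ### Groupoids and their C*-algebras -/

namespace GroupoidCStar

/-- A groupoid, given by its set of arrows; a unit is identified with its identity arrow. The
product `mul a b` is meaningful only if `src a = rng b`. -/
class ArrowGroupoid (Γ : Type*) where
  src : Γ → Γ
  rng : Γ → Γ
  inv : Γ → Γ
  mul : Γ → Γ → Γ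
  src_src : ∀ a, src (src a) = src a
  rng_src : ∀ a, rng (src a) = src a
  src_rng : ∀ a, src (rng a) = rng a
  rng_rng : ∀ a, rng (rng a) = rng a
  src_inv : ∀ a, src (inv a) = rng a
  rng_inv : ∀ a, rng (inv a) = src a
  src_mul : ∀ a b, src a = rng b → src (mul a b) = src b
  rng_mul : ∀ a b, src a = rng b → rng (mul a b) = rng a
  mul_assoc : ∀ a b c, src a = rng b → src b = rng c → mul (mul a b) c = mul a (mul b c)
  mul_src : ∀ a, mul a (src a) = a
  rng_mul_self : ∀ a, mul (rng a) a = a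
  inv_mul : ∀ a, mul (inv a) a = src a
  mul_inv : ∀ a, mul a (inv a) = rng a

open ArrowGroupoid

variable {Γ : Type*} [ArrowGroupoid Γ]

namespace ArrowGroupoid

theorem mul_mul_inv {a b : Γ} (h : src a = rng b) : mul (mul a b) (inv b) = a := by
  rw [mul_assoc _ _ _ h (rng_inv b).symm, mul_inv, ← h, mul_src]

theorem inv_mul_rev {a b : Γ} (h : src a = rng b) : inv (mul a b) = mul (inv b) (inv a) := by
  have h₁ : src (inv b) = rng (inv a) := by rw [src_inv, rng_inv, h]
  have h₂ : src (mul a b) = rng (mul (inv b) (inv a)) := by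
    rw [src_mul _ _ h, rng_mul _ _ h₁, rng_inv]
  have e : mul (mul a b) (mul (inv b) (inv a)) = rng (mul a b) := by
    rw [← mul_assoc _ _ _ (by rw [src_mul _ _ h, rng_inv]) h₁, mul_mul_inv h, mul_inv,
      rng_mul _ _ h]
  calc inv (mul a b) = mul (inv (mul a b)) (mul (mul a b) (mul (inv b) (inv a))) := by
        rw [e, ← src_inv, mul_src]
    _ = mul (inv b) (inv a) := by
        rw [← mul_assoc _ _ _ (src_inv _) h₂, inv_mul, h₂, rng_mul_self]

theorem mul_inv_mul_right {a b c : Γ} (ha : src a = rng c) (hb : src b = rng c) :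
    mul (mul a c) (inv (mul b c)) = mul a (inv b) := by
  have h₁ : src (inv c) = rng (inv b) := by rw [src_inv, rng_inv, hb]
  rw [inv_mul_rev hb, ← mul_assoc _ _ _ (by rw [src_mul _ _ ha, rng_inv]) h₁, mul_mul_inv ha]

theorem mul_left_injective {a b c : Γ} (ha : src a = rng c) (hb : src b = rng c)
    (h : mul a c = mul b c) : a = b := by
  rw [← mul_mul_inv ha, h, mul_mul_inv hb]

end ArrowGroupoid

/-- The arrows of `Γ` with source and range in the set `W` of units. With the subspace topology
and the restricted operations this is the groupoid `W Γ W`. -/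
abbrev Reduction (Γ : Type*) [ArrowGroupoid Γ] (W : Set Γ) : Type _ :=
  {γ : Γ // src γ ∈ W ∧ rng γ ∈ W}

open Classical in
instance (W : Set Γ) : ArrowGroupoid (Reduction Γ W) where
  src a := ⟨src a.1, by rw [src_src, rng_src]; exact ⟨a.2.1, a.2.1⟩⟩
  rng a := ⟨rng a.1, by rw [src_rng, rng_rng]; exact ⟨a.2.2, a.2.2⟩⟩
  inv a := ⟨inv a.1, by rw [src_inv, rng_inv]; exact ⟨a.2.2, a.2.1⟩⟩
  mul a b := if h : src a.1 = rng b.1 then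
    ⟨mul a.1 b.1, by rw [src_mul _ _ h, rng_mul _ _ h]; exact ⟨b.2.1, a.2.2⟩⟩ else a
  src_src a := Subtype.ext (src_src _)
  rng_src a := Subtype.ext (rng_src _)
  src_rng a := Subtype.ext (src_rng _)
  rng_rng a := Subtype.ext (rng_rng _)
  src_inv a := Subtype.ext (src_inv _)
  rng_inv a := Subtype.ext (rng_inv _)
  src_mul a b h := by
    have h' : src a.1 = rng b.1 := congrArg Subtype.val h
    rw [dif_pos h']; exact Subtype.ext (src_mul _ _ h')
  rng_mul a b h := by
    have h' : src a.1 = rng b.1 := congrArg Subtype.val h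
    rw [dif_pos h']; exact Subtype.ext (rng_mul _ _ h')
  mul_assoc a b c h₁ h₂ := by
    have h₁' : src a.1 = rng b.1 := congrArg Subtype.val h₁
    have h₂' : src b.1 = rng c.1 := congrArg Subtype.val h₂
    simp only [dif_pos h₁', dif_pos h₂']
    rw [dif_pos (show src (mul a.1 b.1) = rng c.1 by rw [src_mul _ _ h₁', h₂']),
      dif_pos (show src a.1 = rng (mul b.1 c.1) by rw [rng_mul _ _ h₂', h₁'])]
    exact Subtype.ext (mul_assoc _ _ _ h₁' h₂')
  mul_src a := by
    rw [dif_pos (rng_src a.1).symm]; exact Subtype.ext (mul_src _)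
  rng_mul_self a := by
    rw [dif_pos (src_rng a.1)]; exact Subtype.ext (rng_mul_self _)
  inv_mul a := by
    rw [dif_pos (src_inv a.1)]; exact Subtype.ext (inv_mul _)
  mul_inv a := by
    rw [dif_pos (rng_inv a.1).symm]; exact Subtype.ext (mul_inv _)

theorem Reduction.val_src {W : Set Γ} (a : Reduction Γ W) : (src a).1 = src a.1 := rfl

theorem Reduction.val_rng {W : Set Γ} (a : Reduction Γ W) : (rng a).1 = rng a.1 := rfl

theorem Reduction.val_inv {W : Set Γ} (a : Reduction Γ W) : (inv a).1 = inv a.1 := rfl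

open Classical in
theorem Reduction.val_mul {W : Set Γ} (a b : Reduction Γ W) (h : src a.1 = rng b.1) :
    (mul a b).1 = mul a.1 b.1 := by
  change (dite _ _ _ : Reduction Γ W).1 = _
  rw [dif_pos h]

/-- `W` is a union of orbits. -/
def IsInvariant (W : Set Γ) : Prop := ∀ γ : Γ, src γ ∈ W ↔ rng γ ∈ W

/-- The inclusion of the reduction. -/
def Reduction.emb (W : Set Γ) : Reduction Γ W ↪ Γ := ⟨Subtype.val, Subtype.val_injective⟩

/-- Extension by zero `ℓ²(W Γ W) → ℓ²(Γ)`. -/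
def extOp (W : Set Γ) : Ell2 (Reduction Γ W) →L[ℂ] Ell2 Γ := push (Reduction.emb W)

variable {W : Set Γ}

theorem extOp_delta (a : Reduction Γ W) : extOp W (delta a) = delta a.1 :=
  push_delta (Reduction.emb W) a

theorem extOp_adjoint_apply (x : Ell2 Γ) (a : Reduction Γ W) : (extOp W).adjoint x a = x a.1 :=
  push_adjoint_apply (Reduction.emb W) x a

theorem extOp_apply (x : Ell2 (Reduction Γ W)) (a : Reduction Γ W) : extOp W x a.1 = x a :=
  push_apply (Reduction.emb W) x a

theorem extOp_adjoint_delta (a : Reduction Γ W) : (extOp W).adjoint (delta a.1) = delta a :=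
  push_adjoint_delta (Reduction.emb W) a

theorem adjoint_mul_extOp : (extOp W).adjoint ∘L extOp W = 1 :=
  adjoint_mul_push (Reduction.emb W)

theorem Reduction.notMem_range {γ : Γ} (h : ¬ (src γ ∈ W ∧ rng γ ∈ W)) :
    γ ∉ Set.range (Reduction.emb W) := by
  rintro ⟨a, rfl⟩
  exact h a.2

theorem extOp_adjoint_delta_of_notMem {γ : Γ} (h : ¬ (src γ ∈ W ∧ rng γ ∈ W)) :
    (extOp W).adjoint (delta γ) = 0 :=
  push_adjoint_delta_of_notMem (Reduction.emb W) (Reduction.notMem_range h)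

theorem extOp_apply_of_notMem {γ : Γ} (h : ¬ (src γ ∈ W ∧ rng γ ∈ W))
    (x : Ell2 (Reduction Γ W)) : extOp W x γ = 0 :=
  push_apply_of_notMem (Reduction.emb W) (Reduction.notMem_range h) x

open Classical in
/-- The extension by zero of a function on the reduction. -/
def extFun {W : Set Γ} (f : Reduction Γ W → ℂ) (γ : Γ) : ℂ :=
  if h : src γ ∈ W ∧ rng γ ∈ W then f ⟨γ, h⟩ else 0

theorem extFun_val {W : Set Γ} (f : Reduction Γ W → ℂ) (a : Reduction Γ W) : extFun f a.1 = f a :=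
  dif_pos a.2

theorem extFun_of_notMem {W : Set Γ} (f : Reduction Γ W → ℂ) {γ : Γ} (h : ¬ (src γ ∈ W ∧ rng γ ∈ W)) :
    extFun f γ = 0 := dif_neg h

variable [TopologicalSpace Γ]

/-- Open bisections: open sets on which source and range are homeomorphisms onto their images. -/
def IsOpenBisection (U : Set Γ) : Prop :=
  IsOpen U ∧ Topology.IsEmbedding (fun a : U => src (a : Γ)) ∧
    Topology.IsEmbedding (fun a : U => rng (a : Γ))

/-- `f ∈ C_c(U)`, extended by zero to all of `Γ`. -/
def IsCcOn (U : Set Γ) (f : Γ → ℂ) : Prop :=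
  ContinuousOn f U ∧ ∃ K ⊆ U, IsCompact K ∧ ∀ γ ∉ K, f γ = 0

/-- The linear span of the spaces `C_c(U)`, for `U` an open bisection. -/
def algFunctions (Γ : Type*) [ArrowGroupoid Γ] [TopologicalSpace Γ] : Submodule ℂ (Γ → ℂ) :=
  Submodule.span ℂ {f | ∃ U : Set Γ, IsOpenBisection U ∧ IsCcOn U f}

open Classical in
/-- The operator `T` on `ℓ²(Γ) = ⨁_w ℓ²(Γ w)` is `⨁_w λ_w(f)`, where
`λ_w(f) δ_β = ∑_γ f(γ) δ_{γβ}`; that is, the coefficient of `T δ_β` at `α` is `f(α β⁻¹)` if `α` and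
`β` have the same source, and zero otherwise. -/
def IsRegular (f : Γ → ℂ) (T : Ell2 Γ →L[ℂ] Ell2 Γ) : Prop :=
  ∀ α β : Γ, T (delta β) α = if src α = src β then f (mul α (inv β)) else 0

/-- The reduced C*-algebra of `Γ`: the norm closure, in the bounded operators on `ℓ²(Γ)`, of the
image of `algFunctions Γ` under the sum of the regular representations `λ_w`. -/
def redCStar (Γ : Type*) [ArrowGroupoid Γ] [TopologicalSpace Γ] :
    NonUnitalStarSubalgebra ℂ (Ell2 Γ →L[ℂ] Ell2 Γ) :=
  (NonUnitalStarAlgebra.adjoin ℂ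
    {T : Ell2 Γ →L[ℂ] Ell2 Γ | ∃ f ∈ algFunctions Γ, IsRegular f T}).topologicalClosure

set_option synthInstance.maxHeartbeats 400000 in
instance : NonUnitalRing (redCStar Γ) := inferInstance

set_option synthInstance.maxHeartbeats 400000 in
instance : Module ℂ (redCStar Γ) := inferInstance

instance : SMul ℂ (redCStar Γ) := Module.toDistribMulAction.toSMul

set_option synthInstance.maxHeartbeats 400000 in
instance : StarRing (redCStar Γ) := inferInstance

set_option synthInstance.maxHeartbeats 400000 in
instance : IsScalarTower ℂ (redCStar Γ) (redCStar Γ) := inferInstance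

set_option synthInstance.maxHeartbeats 400000 in
instance : SMulCommClass ℂ (redCStar Γ) (redCStar Γ) := inferInstance

set_option synthInstance.maxHeartbeats 400000 in
instance : StarModule ℂ (redCStar Γ) := inferInstance

/-- An element of the reduced C*-algebra, seen as a function on `Γ`. On `algFunctions Γ` this is
the inclusion into the functions on `Γ`. -/
def evalFun (a : redCStar Γ) (γ : Γ) : ℂ := a.1 (delta (src γ)) γ

/-- Singular elements of the reduced C*-algebra: their support has empty interior. -/
def IsSingular (a : redCStar Γ) : Prop := interior (Function.support (evalFun a)) = ∅

theorem redCStar_le {S : NonUnitalStarSubalgebra ℂ (Ell2 Γ →L[ℂ] Ell2 Γ)}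
    (hS : IsClosed (S : Set (Ell2 Γ →L[ℂ] Ell2 Γ)))
    (h : ∀ f ∈ algFunctions Γ, ∀ T, IsRegular f T → T ∈ S) : redCStar Γ ≤ S :=
  NonUnitalStarSubalgebra.topologicalClosure_minimal _
    (NonUnitalStarAlgebra.adjoin_le fun T ⟨f, hf, hT⟩ => h f hf T hT) hS

theorem mem_redCStar {f : Γ → ℂ} (hf : f ∈ algFunctions Γ) {T : Ell2 Γ →L[ℂ] Ell2 Γ}
    (hT : IsRegular f T) : T ∈ redCStar Γ :=
  NonUnitalStarSubalgebra.le_topologicalClosure _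
    (NonUnitalStarAlgebra.subset_adjoin ℂ _ ⟨f, hf, hT⟩)

theorem isClosed_redCStar : IsClosed (redCStar Γ : Set (Ell2 Γ →L[ℂ] Ell2 Γ)) :=
  NonUnitalStarSubalgebra.isClosed_topologicalClosure _

/-! ### Reductions to invariant sets of units -/

section Reduction

variable {W : Set Γ}

theorem isOpenBisection_image (hW : IsOpen {γ : Γ | src γ ∈ W ∧ rng γ ∈ W})
    {U : Set (Reduction Γ W)} (hU : IsOpenBisection U) :
    IsOpenBisection (Subtype.val '' U) := by
  have hmem : ∀ a : (Subtype.val '' U : Set Γ), src a.1 ∈ W ∧ rng a.1 ∈ W := by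
    rintro ⟨_, a, _, rfl⟩; exact a.2
  have hmemU : ∀ a : (Subtype.val '' U : Set Γ), (⟨a.1, hmem a⟩ : Reduction Γ W) ∈ U := by
    rintro ⟨_, a, ha, rfl⟩; exact ha
  have e : Topology.IsEmbedding (fun a : (Subtype.val '' U : Set Γ) =>
      (⟨⟨a.1, hmem a⟩, hmemU a⟩ : U)) :=
    Topology.IsEmbedding.of_comp (by fun_prop)
      (continuous_subtype_val.comp continuous_subtype_val) Topology.IsEmbedding.subtypeVal
  refine ⟨hW.isOpenMap_subtype_val _ hU.1, ?_, ?_⟩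
  · exact Topology.IsEmbedding.subtypeVal.comp (hU.2.1.comp e)
  · exact Topology.IsEmbedding.subtypeVal.comp (hU.2.2.comp e)

theorem isOpenBisection_preimage {U : Set Γ} (hU : IsOpenBisection U) :
    IsOpenBisection (Subtype.val ⁻¹' U : Set (Reduction Γ W)) := by
  have e : Topology.IsEmbedding (fun a : (Subtype.val ⁻¹' U : Set (Reduction Γ W)) =>
      (⟨a.1.1, a.2⟩ : U)) :=
    Topology.IsEmbedding.of_comp (by fun_prop) continuous_subtype_val
      (f := fun a : (Subtype.val ⁻¹' U : Set (Reduction Γ W)) => (⟨a.1.1, a.2⟩ : U))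
      (Topology.IsEmbedding.comp (g := Subtype.val) (f := Subtype.val)
        Topology.IsEmbedding.subtypeVal Topology.IsEmbedding.subtypeVal)
  refine ⟨hU.1.preimage continuous_subtype_val, ?_, ?_⟩
  · exact Topology.IsEmbedding.subtypeVal.of_comp_iff.1 (hU.2.1.comp e)
  · exact Topology.IsEmbedding.subtypeVal.of_comp_iff.1 (hU.2.2.comp e)

theorem extend_mem_algFunctions (hW : IsOpen {γ : Γ | src γ ∈ W ∧ rng γ ∈ W})
    {f : Reduction Γ W → ℂ} (hf : f ∈ algFunctions (Reduction Γ W)) :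
    extFun f ∈ algFunctions Γ := by
  induction hf using Submodule.span_induction with
  | mem f hf =>
    obtain ⟨U, hU, hf, K, hKU, hK, hf0⟩ := hf
    refine Submodule.subset_span ⟨Subtype.val '' U, isOpenBisection_image hW hU, ?_,
      Subtype.val '' K, Set.image_mono hKU, hK.image continuous_subtype_val, ?_⟩
    · rintro _ ⟨a, ha, rfl⟩
      have h₁ : ContinuousAt f a := hf.continuousAt (hU.1.mem_nhds ha)
      refine ContinuousAt.continuousWithinAt ?_
      refine (hW.isOpenEmbedding_subtypeVal.continuousAt_iff (x := a)).1 ?_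
      refine h₁.congr (Filter.Eventually.of_forall fun b => ?_)
      exact (extFun_val f b).symm
    · intro γ hγ
      by_cases h : src γ ∈ W ∧ rng γ ∈ W
      · exact (extFun_val f ⟨γ, h⟩).trans (hf0 _ fun h' => hγ ⟨_, h', rfl⟩)
      · exact extFun_of_notMem f h
  | zero =>
    convert (algFunctions Γ).zero_mem using 1
    ext γ; by_cases h : src γ ∈ W ∧ rng γ ∈ W <;> simp [extFun, h]
  | add f g _ _ hf hg =>
    convert (algFunctions Γ).add_mem hf hg using 1
    ext γ; by_cases h : src γ ∈ W ∧ rng γ ∈ W <;> simp [extFun, h]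
  | smul c f _ hf =>
    convert (algFunctions Γ).smul_mem c hf using 1
    ext γ; by_cases h : src γ ∈ W ∧ rng γ ∈ W <;> simp [extFun, h]

theorem restrict_mem_algFunctions (hW : IsClosed {γ : Γ | src γ ∈ W ∧ rng γ ∈ W})
    {f : Γ → ℂ} (hf : f ∈ algFunctions Γ) :
    (fun a : Reduction Γ W => f a.1) ∈ algFunctions (Reduction Γ W) := by
  induction hf using Submodule.span_induction with
  | mem f hf =>
    obtain ⟨U, hU, hf, K, hKU, hK, hf0⟩ := hf
    refine Submodule.subset_span ⟨_, isOpenBisection_preimage hU, ?_,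
      Subtype.val ⁻¹' K, Set.preimage_mono hKU, ?_, fun a ha => hf0 _ ha⟩
    · exact hf.comp continuous_subtype_val.continuousOn fun _ h => h
    · exact hW.isClosedEmbedding_subtypeVal.isCompact_preimage hK
  | zero => exact (algFunctions _).zero_mem
  | add f g _ _ hf hg => exact (algFunctions _).add_mem hf hg
  | smul c f _ hf => exact (algFunctions _).smul_mem c hf

/-- `T ↦ S T S*` for the isometry `S = extOp W`. -/
def conjExt (W : Set Γ) : (Ell2 (Reduction Γ W) →L[ℂ] Ell2 (Reduction Γ W)) →⋆ₙₐ[ℂ]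
    (Ell2 Γ →L[ℂ] Ell2 Γ) where
  toFun T := extOp W ∘L T ∘L (extOp W).adjoint
  map_smul' c T := by ext; simp
  map_zero' := by ext; simp
  map_add' S T := by ext; simp
  map_mul' S T := by
    have h : ∀ x, (extOp W).adjoint (extOp W x) = x := fun x =>
      DFunLike.congr_fun (adjoint_mul_extOp (W := W)) x
    ext1 x
    simp [h]
  map_star' T := by
    simp only [ContinuousLinearMap.star_eq_adjoint, ContinuousLinearMap.adjoint_comp,
      ContinuousLinearMap.adjoint_adjoint, ContinuousLinearMap.comp_assoc]

theorem conjExt_continuous : Continuous (conjExt W) := by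
  change Continuous fun T => extOp W ∘L T ∘L (extOp W).adjoint
  fun_prop

theorem conjExt_isRegular (hinv : IsInvariant W) {f : Reduction Γ W → ℂ}
    {T : Ell2 (Reduction Γ W) →L[ℂ] Ell2 (Reduction Γ W)} (hT : IsRegular f T) :
    IsRegular (extFun f) (conjExt W T) := by
  intro α β
  change extOp W (T ((extOp W).adjoint (delta β))) α = _
  by_cases hβ : src β ∈ W ∧ rng β ∈ W
  · obtain ⟨b, rfl⟩ : ∃ b : Reduction Γ W, b.1 = β := ⟨⟨β, hβ⟩, rfl⟩
    rw [extOp_adjoint_delta]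
    by_cases hα : src α ∈ W ∧ rng α ∈ W
    · obtain ⟨a, rfl⟩ : ∃ a : Reduction Γ W, a.1 = α := ⟨⟨α, hα⟩, rfl⟩
      rw [extOp_apply, hT]
      by_cases h : src a.1 = src b.1
      · rw [if_pos h, if_pos (Subtype.ext h), ← extFun_val f, Reduction.val_mul, Reduction.val_inv]
        rw [Reduction.val_inv, rng_inv, h]
      · rw [if_neg h, if_neg fun h' => h (congrArg Subtype.val h')]
    · rw [extOp_apply_of_notMem hα, if_neg]
      intro h
      exact hα ⟨h ▸ hβ.1, (hinv α).1 (h ▸ hβ.1)⟩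
  · rw [extOp_adjoint_delta_of_notMem hβ, map_zero, map_zero]
    split_ifs with h
    · refine (extFun_of_notMem f fun h' => hβ ?_).symm
      rw [src_mul _ _ (by rw [rng_inv, h]), src_inv] at h'
      exact ⟨(hinv β).2 h'.1, h'.1⟩
    · rfl

theorem conjExt_mem (hW : IsOpen {γ : Γ | src γ ∈ W ∧ rng γ ∈ W}) (hinv : IsInvariant W)
    {T} (hT : T ∈ redCStar (Reduction Γ W)) : conjExt W T ∈ redCStar Γ := by
  have h : redCStar (Reduction Γ W) ≤ (redCStar Γ).comap (conjExt W) :=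
    redCStar_le (isClosed_redCStar.preimage conjExt_continuous) fun f hf T hT =>
      mem_redCStar (extend_mem_algFunctions hW hf) (conjExt_isRegular hinv hT)
  exact h hT

/-- For an open invariant set `W` of units, the inclusion of the reduced C*-algebra of `W Γ W` into
the one of `Γ`, given by the extension of functions by zero. -/
def inclRed (W : Set Γ) (hW : IsOpen {γ : Γ | src γ ∈ W ∧ rng γ ∈ W}) (hinv : IsInvariant W) :
    redCStar (Reduction Γ W) →⋆ₙₐ[ℂ] redCStar Γ :=
  NonUnitalStarAlgHom.codRestrict
    ((conjExt W).comp (NonUnitalStarSubalgebraClass.subtype (redCStar (Reduction Γ W))))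
    (redCStar Γ) fun a => conjExt_mem hW hinv a.2

/-- `T ↦ S* T S` for the isometry `S = extOp W`. -/
def compress (W : Set Γ) (T : Ell2 Γ →L[ℂ] Ell2 Γ) :
    Ell2 (Reduction Γ W) →L[ℂ] Ell2 (Reduction Γ W) := (extOp W).adjoint ∘L T ∘L extOp W

theorem compress_continuous : Continuous (compress W) := by
  unfold compress; fun_prop

theorem compress_add (S T : Ell2 Γ →L[ℂ] Ell2 Γ) :
    compress W (S + T) = compress W S + compress W T := by
  ext1 x; simp [compress]

theorem compress_smul (c : ℂ) (T : Ell2 Γ →L[ℂ] Ell2 Γ) :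
    compress W (c • T) = c • compress W T := by
  ext1 x; simp [compress]

theorem compress_star (T : Ell2 Γ →L[ℂ] Ell2 Γ) :
    compress W (star T) = star (compress W T) := by
  simp only [compress, ContinuousLinearMap.star_eq_adjoint, ContinuousLinearMap.adjoint_comp,
    ContinuousLinearMap.adjoint_adjoint, ContinuousLinearMap.comp_assoc]

/-- The projection of `ℓ²(Γ)` onto `ℓ²(W Γ W)`. -/
def redProj (W : Set Γ) : Ell2 Γ →L[ℂ] Ell2 Γ := extOp W ∘L (extOp W).adjoint

theorem redProj_extOp (x : Ell2 (Reduction Γ W)) : redProj W (extOp W x) = extOp W x :=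
  congrArg (extOp W) (DFunLike.congr_fun (adjoint_mul_extOp (W := W)) x)

theorem compress_mul {S T : Ell2 Γ →L[ℂ] Ell2 Γ} (hT : redProj W * T = T * redProj W) :
    compress W (S * T) = compress W S * compress W T := by
  ext1 x
  have h : extOp W ((extOp W).adjoint (T (extOp W x))) = T (extOp W x) :=
    (DFunLike.congr_fun hT (extOp W x)).trans (congrArg T (redProj_extOp x))
  simp [compress, h]

theorem compress_isRegular {f : Γ → ℂ} {T : Ell2 Γ →L[ℂ] Ell2 Γ} (hT : IsRegular f T) :
    IsRegular (fun a : Reduction Γ W => f a.1) (compress W T) := by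
  intro a b
  change (extOp W).adjoint (T (extOp W (delta b))) a = _
  rw [extOp_delta, extOp_adjoint_apply, hT]
  by_cases h : src a.1 = src b.1
  · rw [if_pos h, if_pos (Subtype.ext h)]
    refine congrArg f (Reduction.val_mul a (inv b) ?_).symm
    rw [Reduction.val_inv, rng_inv, h]
  · rw [if_neg h, if_neg fun h' => h (congrArg Subtype.val h')]

theorem redProj_delta {β : Γ} (hβ : src β ∈ W ∧ rng β ∈ W) :
    redProj W (delta β) = delta β := by
  obtain ⟨b, rfl⟩ : ∃ b : Reduction Γ W, b.1 = β := ⟨⟨β, hβ⟩, rfl⟩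
  rw [← extOp_delta, redProj_extOp]

theorem redProj_delta_of_notMem {β : Γ} (hβ : ¬ (src β ∈ W ∧ rng β ∈ W)) :
    redProj W (delta β) = 0 := by
  change extOp W ((extOp W).adjoint (delta β)) = 0
  rw [extOp_adjoint_delta_of_notMem hβ, map_zero]

theorem redProj_apply (x : Ell2 Γ) {α : Γ} (hα : src α ∈ W ∧ rng α ∈ W) :
    redProj W x α = x α := by
  obtain ⟨a, rfl⟩ : ∃ a : Reduction Γ W, a.1 = α := ⟨⟨α, hα⟩, rfl⟩
  exact (extOp_apply _ a).trans (extOp_adjoint_apply x a)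

theorem redProj_star : star (redProj W) = redProj W := by
  simp only [redProj, ContinuousLinearMap.star_eq_adjoint, ContinuousLinearMap.adjoint_comp,
    ContinuousLinearMap.adjoint_adjoint]

theorem redProj_comm_of_isRegular (hinv : IsInvariant W) {f : Γ → ℂ}
    {T : Ell2 Γ →L[ℂ] Ell2 Γ} (hT : IsRegular f T) : redProj W * T = T * redProj W := by
  refine clm_eq fun α β => ?_
  change redProj W (T (delta β)) α = T (redProj W (delta β)) α
  have hW : ∀ γ, (src γ ∈ W ∧ rng γ ∈ W) ↔ src γ ∈ W := fun γ =>
    ⟨fun h => h.1, fun h => ⟨h, (hinv γ).1 h⟩⟩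
  by_cases hα : src α ∈ W ∧ rng α ∈ W <;> by_cases hβ : src β ∈ W ∧ rng β ∈ W
  · rw [redProj_apply _ hα, redProj_delta hβ]
  · rw [redProj_apply _ hα, redProj_delta_of_notMem hβ, map_zero, hT, if_neg]
    · rfl
    · intro h; rw [hW, h] at hα; rw [hW] at hβ; exact hβ hα
  · rw [redProj_delta hβ, hT, if_neg]
    · exact extOp_apply_of_notMem hα _
    · intro h; rw [hW, h] at hα; rw [hW] at hβ; exact hα hβ
  · rw [redProj_delta_of_notMem hβ, map_zero]
    exact extOp_apply_of_notMem hα _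

theorem redCStar_le_centralizer (P : Ell2 Γ →L[ℂ] Ell2 Γ)
    (h : ∀ f ∈ algFunctions Γ, ∀ T, IsRegular f T →
      P * T = T * P ∧ star P * T = T * star P) {T} (hT : T ∈ redCStar Γ) : P * T = T * P := by
  have key : redCStar Γ ≤ NonUnitalStarSubalgebra.centralizer ℂ {P} := by
    refine redCStar_le ?_ fun f hf T hT => ?_
    · rw [NonUnitalStarSubalgebra.coe_centralizer]
      exact Set.isClosed_centralizer _
    · rw [NonUnitalStarSubalgebra.mem_centralizer_iff]
      rintro Q rfl
      exact h f hf T hT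
  exact ((NonUnitalStarSubalgebra.mem_centralizer_iff ℂ).1 (key hT) P rfl).1

theorem redProj_comm (hinv : IsInvariant W) {T} (hT : T ∈ redCStar Γ) :
    redProj W * T = T * redProj W :=
  redCStar_le_centralizer (redProj W) (fun _ _ T hT => by
    rw [redProj_star]
    exact ⟨redProj_comm_of_isRegular hinv hT, redProj_comm_of_isRegular hinv hT⟩) hT

theorem compress_mem (hW : IsClosed {γ : Γ | src γ ∈ W ∧ rng γ ∈ W}) (hinv : IsInvariant W)
    {T} (hT : T ∈ redCStar Γ) : compress W T ∈ redCStar (Reduction Γ W) := by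
  have hadj : ∀ T ∈ NonUnitalStarAlgebra.adjoin ℂ
      {T : Ell2 Γ →L[ℂ] Ell2 Γ | ∃ f ∈ algFunctions Γ, IsRegular f T},
      compress W T ∈ redCStar (Reduction Γ W) := by
    intro T hT
    induction hT using NonUnitalStarAlgebra.adjoin_induction with
    | mem T hT =>
      obtain ⟨f, hf, hT⟩ := hT
      exact mem_redCStar (restrict_mem_algFunctions hW hf) (compress_isRegular hT)
    | add S T _ _ hS hT => rw [compress_add]; exact add_mem hS hT
    | zero =>
      have : compress W (0 : Ell2 Γ →L[ℂ] Ell2 Γ) = 0 := by ext1 x; simp [compress]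
      rw [this]; exact zero_mem _
    | mul S T _ hT' hS hT =>
      rw [compress_mul (redProj_comm hinv (NonUnitalStarSubalgebra.le_topologicalClosure _ hT'))]
      exact mul_mem hS hT
    | smul c T _ hT => rw [compress_smul]; exact SMulMemClass.smul_mem c hT
    | star T _ hT => rw [compress_star]; exact star_mem hT
  exact closure_minimal hadj (isClosed_redCStar.preimage compress_continuous) hT

/-- For a closed invariant set `W` of units, the homomorphism of reduced C*-algebras from the one of
`Γ` to the one of `W Γ W`, given by the restriction of functions. -/
def restrRed (W : Set Γ) (hW : IsClosed {γ : Γ | src γ ∈ W ∧ rng γ ∈ W}) (hinv : IsInvariant W) :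
    redCStar Γ →⋆ₙₐ[ℂ] redCStar (Reduction Γ W) where
  toFun a := ⟨compress W a.1, compress_mem hW hinv a.2⟩
  map_smul' c a := Subtype.ext (compress_smul c a.1)
  map_zero' := Subtype.ext (by ext1 x; simp [compress])
  map_add' a b := Subtype.ext (compress_add a.1 b.1)
  map_mul' a b := Subtype.ext (compress_mul (redProj_comm hinv b.2))
  map_star' a := Subtype.ext (compress_star a.1)

end Reduction

/-! ### The essential C*-algebra -/

theorem evalFun_add (a b : redCStar Γ) (γ : Γ) :
    evalFun (a + b) γ = evalFun a γ + evalFun b γ := rfl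

theorem evalFun_smul (c : ℂ) (a : redCStar Γ) (γ : Γ) : evalFun (c • a) γ = c * evalFun a γ := rfl

/-- The singular elements of the reduced C*-algebra of `Γ` form a star-closed two-sided ideal. -/
class HasSingularIdeal (Γ : Type*) [ArrowGroupoid Γ] [TopologicalSpace Γ] : Prop where
  add_mem : ∀ a b : redCStar Γ, IsSingular a → IsSingular b → IsSingular (a + b)
  mul_left_mem : ∀ a b : redCStar Γ, IsSingular b → IsSingular (a * b)
  mul_right_mem : ∀ a b : redCStar Γ, IsSingular a → IsSingular (a * b)
  star_mem : ∀ a : redCStar Γ, IsSingular a → IsSingular (star a)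

theorem isSingular_zero : IsSingular (0 : redCStar Γ) := by
  have h : Function.support (evalFun (0 : redCStar Γ)) = ∅ :=
    Function.support_eq_empty_iff.2 (funext fun γ => rfl)
  rw [IsSingular, h, interior_empty]

theorem IsSingular.smul (c : ℂ) {a : redCStar Γ} (ha : IsSingular a) : IsSingular (c • a) := by
  refine Set.subset_eq_empty (interior_mono fun γ hγ => ?_) ha
  rw [Function.mem_support, evalFun_smul] at hγ
  exact right_ne_zero_of_mul hγ

/-- The ideal `J` of all singular elements of the reduced C*-algebra. -/
def singularIdeal (Γ : Type*) [ArrowGroupoid Γ] [TopologicalSpace Γ] [HasSingularIdeal Γ] :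
    StarIdeal (redCStar Γ) where
  carrier := {a | IsSingular a}
  zero_mem' := isSingular_zero
  add_mem' := HasSingularIdeal.add_mem _ _
  smul_mem' c _ ha := IsSingular.smul c ha
  mul_left_mem := HasSingularIdeal.mul_left_mem
  mul_right_mem := HasSingularIdeal.mul_right_mem
  star_mem' := HasSingularIdeal.star_mem

/-- The essential C*-algebra of `Γ`: the quotient of the reduced C*-algebra by `J`. -/
abbrev EssCStar (Γ : Type*) [ArrowGroupoid Γ] [TopologicalSpace Γ] [HasSingularIdeal Γ] : Type _ :=
  (singularIdeal Γ).Quot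

theorem evalFun_inclRed {W : Set Γ} (hW : IsOpen {γ : Γ | src γ ∈ W ∧ rng γ ∈ W})
    (hinv : IsInvariant W) (a : redCStar (Reduction Γ W)) :
    evalFun (inclRed W hW hinv a) = extFun (evalFun a) := by
  ext γ
  change extOp W (a.1 ((extOp W).adjoint (delta (src γ)))) γ = _
  by_cases h : src γ ∈ W ∧ rng γ ∈ W
  · obtain ⟨b, rfl⟩ : ∃ b : Reduction Γ W, b.1 = γ := ⟨⟨γ, h⟩, rfl⟩
    rw [extFun_val, extOp_apply, ← Reduction.val_src, extOp_adjoint_delta]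
    rfl
  · rw [extOp_apply_of_notMem h, extFun_of_notMem _ h]

theorem inclRed_isSingular {W : Set Γ} (hW : IsOpen {γ : Γ | src γ ∈ W ∧ rng γ ∈ W})
    (hinv : IsInvariant W) {a : redCStar (Reduction Γ W)} (ha : IsSingular a) :
    IsSingular (inclRed W hW hinv a) := by
  rw [IsSingular, Set.eq_empty_iff_forall_notMem]
  intro γ hγ
  have hγ' := interior_subset hγ
  rw [Function.mem_support, evalFun_inclRed] at hγ'
  have h : src γ ∈ W ∧ rng γ ∈ W := by
    by_contra h
    exact hγ' (extFun_of_notMem _ h)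
  have hmem : (⟨γ, h⟩ : Reduction Γ W) ∈ interior (Function.support (evalFun a)) := by
    refine mem_interior.2 ⟨Subtype.val ⁻¹' interior _, fun b hb => ?_,
      isOpen_interior.preimage continuous_subtype_val, hγ⟩
    have := interior_subset hb
    rw [Function.mem_support, evalFun_inclRed, extFun_val] at this
    exact this
  rw [ha] at hmem
  exact hmem

/-- The homomorphism of essential C*-algebras induced by `inclRed`. -/
def inclEss (W : Set Γ) (hW : IsOpen {γ : Γ | src γ ∈ W ∧ rng γ ∈ W}) (hinv : IsInvariant W)
    [HasSingularIdeal Γ] [HasSingularIdeal (Reduction Γ W)] :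
    EssCStar (Reduction Γ W) →⋆ₙₐ[ℂ] EssCStar Γ :=
  (singularIdeal (Reduction Γ W)).lift ((singularIdeal Γ).quotHom.comp (inclRed W hW hinv))
    fun a ha => by
      change (singularIdeal Γ).toQuot (inclRed W hW hinv a) = 0
      rw [← map_zero (singularIdeal Γ).toQuot, StarIdeal.toQuot_eq, sub_zero]
      exact inclRed_isSingular hW hinv ha

/-! ### The singular ideal in the presence of many isolated points -/

section Translation

/-- Right translation by `κ`: `δ_α ↦ δ_{ακ}` if `α` and `κ` are composable, and `δ_α ↦ 0` if not. -/
def rightTrans (κ : Γ) : Ell2 Γ →L[ℂ] Ell2 Γ :=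
  push (⟨fun α : {α : Γ // src α = rng κ} => mul α.1 κ, fun α β h =>
    Subtype.ext (mul_left_injective α.2 β.2 h)⟩ : {α : Γ // src α = rng κ} ↪ Γ) ∘L
  (push (Function.Embedding.subtype fun α : Γ => src α = rng κ)).adjoint

theorem rightTrans_delta {κ α : Γ} (h : src α = rng κ) :
    rightTrans κ (delta α) = delta (mul α κ) := by
  change push _ ((push _).adjoint (delta α)) = _
  rw [show α = (Function.Embedding.subtype fun α : Γ => src α = rng κ) ⟨α, h⟩ from rfl,
    push_adjoint_delta, push_delta]
  rfl

theorem rightTrans_delta_of_ne {κ α : Γ} (h : src α ≠ rng κ) :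
    rightTrans κ (delta α) = 0 := by
  change push _ ((push _).adjoint (delta α)) = _
  rw [push_adjoint_delta_of_notMem, map_zero]
  rintro ⟨a, rfl⟩
  exact h a.2

theorem rightTrans_apply (x : Ell2 Γ) {κ α : Γ} (h : src α = rng κ) :
    rightTrans κ x (mul α κ) = x α := by
  change push _ ((push _).adjoint x) _ = _
  refine (push_apply (⟨fun α : {α : Γ // src α = rng κ} => mul α.1 κ, fun α β h =>
    Subtype.ext (mul_left_injective α.2 β.2 h)⟩ : {α : Γ // src α = rng κ} ↪ Γ) _ ⟨α, h⟩).trans ?_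
  rw [push_adjoint_apply]
  rfl

theorem rightTrans_apply_of_ne (x : Ell2 Γ) {κ α : Γ} (h : src α ≠ src κ) :
    rightTrans κ x α = 0 := by
  refine push_apply_of_notMem _ ?_ _
  rintro ⟨a, rfl⟩
  exact h (src_mul _ _ a.2)

theorem rightTrans_star (κ : Γ) : star (rightTrans κ) = rightTrans (inv κ) := by
  refine clm_eq fun α β => ?_
  rw [← inner_delta, ContinuousLinearMap.star_eq_adjoint, ContinuousLinearMap.adjoint_inner_right,
    ← inner_conj_symm, inner_delta]
  have key : ∀ {α β : Γ}, src α = rng κ → src β = src κ → (mul α κ = β ↔ mul β (inv κ) = α) := by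
    intro α β hα hβ
    constructor
    · rintro rfl; exact mul_mul_inv hα
    · rintro rfl
      rw [mul_assoc _ _ _ (by rw [rng_inv, hβ]) (src_inv κ), inv_mul, ← hβ, mul_src]
  by_cases hα : src α = rng κ
  · rw [rightTrans_delta hα]
    by_cases hβ : src β = src κ
    · rw [rightTrans_delta (by rw [rng_inv, hβ]), delta_apply, delta_apply]
      have := key hα hβ
      by_cases h : mul α κ = β
      · rw [if_pos h.symm, if_pos (this.1 h).symm, map_one]
      · rw [if_neg fun h' => h h'.symm, if_neg fun h' => h (this.2 h'.symm), map_zero]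
    · rw [rightTrans_delta_of_ne (by rwa [rng_inv]), delta_apply, if_neg, map_zero]
      · rfl
      · rintro rfl; exact hβ (src_mul _ _ hα)
  · rw [rightTrans_delta_of_ne hα, rightTrans_apply_of_ne _ (by rwa [src_inv])]
    exact map_zero _

theorem rightTrans_comm_of_isRegular (κ : Γ) {f : Γ → ℂ} {T : Ell2 Γ →L[ℂ] Ell2 Γ}
    (hT : IsRegular f T) : rightTrans κ * T = T * rightTrans κ := by
  refine clm_eq fun α β => ?_
  change rightTrans κ (T (delta β)) α = T (rightTrans κ (delta β)) α
  by_cases hα : src α = src κ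
  · obtain ⟨a, ha, rfl⟩ : ∃ a, src a = rng κ ∧ mul a κ = α :=
      ⟨mul α (inv κ), by rw [src_mul _ _ (by rw [rng_inv, hα]), src_inv], by
        rw [mul_assoc _ _ _ (by rw [rng_inv, hα]) (src_inv κ), inv_mul, ← hα, mul_src]⟩
    rw [rightTrans_apply _ ha, hT]
    by_cases hβ : src β = rng κ
    · rw [rightTrans_delta hβ, hT, if_pos (by rw [ha, hβ]),
        if_pos (by rw [src_mul _ _ ha, src_mul _ _ hβ]), mul_inv_mul_right ha hβ]
    · rw [rightTrans_delta_of_ne hβ, map_zero, if_neg]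
      · rfl
      · intro h; exact hβ (h.symm.trans ha)
  · rw [rightTrans_apply_of_ne _ hα]
    by_cases hβ : src β = rng κ
    · rw [rightTrans_delta hβ, hT, if_neg]
      rwa [src_mul _ _ hβ]
    · rw [rightTrans_delta_of_ne hβ, map_zero]
      rfl

theorem rightTrans_comm (κ : Γ) (a : redCStar Γ) (x : Ell2 Γ) :
    rightTrans κ (a.1 x) = a.1 (rightTrans κ x) :=
  DFunLike.congr_fun (redCStar_le_centralizer (rightTrans κ) (fun _ _ T hT => by
    rw [rightTrans_star]
    exact ⟨rightTrans_comm_of_isRegular _ hT, rightTrans_comm_of_isRegular _ hT⟩) a.2) x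

theorem apply_eq_zero_of_src_ne (a : redCStar Γ) {α β : Γ} (h : src α ≠ src β) :
    a.1 (delta β) α = 0 := by
  have h₁ : rightTrans (src β) (delta β) = delta β := by
    rw [rightTrans_delta (rng_src β).symm, mul_src]
  rw [← h₁, ← rightTrans_comm]
  exact rightTrans_apply_of_ne _ (by rwa [src_src])

end Translation

section Isolated

variable {D : Set Γ}

/-- `a` is singular if and only if it vanishes on a dense set of isolated points which is closed
under passing to arrows with the same source and to ranges. -/
theorem isSingular_iff (hD : ∀ γ ∈ D, IsOpen {γ}) (hdense : Dense D)
    (hsrc : ∀ γ β, γ ∈ D → src β = src γ → β ∈ D) (hrng : ∀ γ ∈ D, rng γ ∈ D) (a : redCStar Γ) :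
    IsSingular a ↔ ∀ β ∈ D, a.1 (delta β) = 0 := by
  constructor
  · intro ha
    have h₁ : ∀ γ ∈ D, evalFun a γ = 0 := by
      intro γ hγ
      by_contra h
      have : γ ∈ interior (Function.support (evalFun a)) :=
        mem_interior.2 ⟨{γ}, Set.singleton_subset_iff.2 h, hD γ hγ, rfl⟩
      rw [ha] at this
      exact this
    have h₂ : ∀ u ∈ D, src u = u → a.1 (delta u) = 0 := by
      intro u hu hsu
      ext α
      by_cases h : src α = u
      · have := h₁ α (hsrc u α hu (by rw [h, hsu]))
        rw [evalFun, h] at this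
        exact this
      · exact apply_eq_zero_of_src_ne a (by rwa [hsu])
    intro β hβ
    have h₃ : rightTrans β (delta (rng β)) = delta β := by
      rw [rightTrans_delta (src_rng β), rng_mul_self]
    rw [← h₃, ← rightTrans_comm, h₂ _ (hrng β hβ) (src_rng β), map_zero]
  · intro h
    rw [IsSingular, Set.eq_empty_iff_forall_notMem]
    intro γ hγ
    obtain ⟨δ, hδ, hδD⟩ := hdense.inter_open_nonempty _ isOpen_interior ⟨γ, hγ⟩
    have h₁ := interior_subset hδ
    refine h₁ ?_
    rw [evalFun, h _ (hsrc δ _ hδD (src_src δ))]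
    rfl

theorem HasSingularIdeal.of_isolated (hD : ∀ γ ∈ D, IsOpen {γ}) (hdense : Dense D)
    (hsrc : ∀ γ β, γ ∈ D → src β = src γ → β ∈ D) (hrng : ∀ γ ∈ D, rng γ ∈ D) :
    HasSingularIdeal Γ := by
  have key := isSingular_iff hD hdense hsrc hrng
  constructor
  · intro a b ha hb
    rw [key] at ha hb ⊢
    intro β hβ
    change a.1 (delta β) + b.1 (delta β) = 0
    rw [ha β hβ, hb β hβ, add_zero]
  · intro a b hb
    rw [key] at hb ⊢
    intro β hβ
    change a.1 (b.1 (delta β)) = 0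
    rw [hb β hβ, map_zero]
  · intro a b ha
    rw [key] at ha ⊢
    intro β hβ
    change a.1 (b.1 (delta β)) = 0
    have h₁ := (hasSum_delta (b.1 (delta β))).mapL a.1
    have h₂ : (fun α => a.1 (b.1 (delta β) α • delta α)) = fun _ => 0 := by
      funext α
      by_cases h : src α = src β
      · rw [map_smul, ha α (hsrc β α hβ h), smul_zero]
      · rw [apply_eq_zero_of_src_ne b h, zero_smul, map_zero]
    rw [h₂] at h₁
    exact h₁.unique hasSum_zero
  · intro a ha
    rw [key] at ha ⊢
    intro β hβ
    ext α
    change (star a.1) (delta β) α = 0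
    rw [← inner_delta, ContinuousLinearMap.star_eq_adjoint,
      ContinuousLinearMap.adjoint_inner_right, ← inner_conj_symm, inner_delta]
    by_cases h : src α = src β
    · rw [ha α (hsrc β α hβ h)]
      exact map_zero _
    · rw [apply_eq_zero_of_src_ne a fun h' => h h'.symm, map_zero]

end Isolated

end GroupoidCStar

/-! ### The bundle of groups -/

namespace BundleExample

open GroupoidCStar ArrowGroupoid Filter Topology

/-- The arrows of the bundle of groups: `X = {x i j}` with trivial isotropy, `ℤ/2 × Y`, `G × Z` and
`G × {ε}`, where `Y = {y i}`, `Z = {z i}` and `G = ℤ/2 × H`. -/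
inductive Bundle (H : Type*) : Type _
  | x (i j : ℕ) : Bundle H
  | y (n : ZMod 2) (i : ℕ) : Bundle H
  | z (n : ZMod 2) (h : H) (i : ℕ) : Bundle H
  | e (n : ZMod 2) (h : H) : Bundle H

namespace Bundle

variable {H : Type*} [Group H]

/-- Source and range of an arrow. -/
def unit : Bundle H → Bundle H
  | x i j => x i j
  | y _ i => y 0 i
  | z _ _ i => z 0 1 i
  | e _ _ => e 0 1

/-- The inverse of an arrow. -/
protected def inverse : Bundle H → Bundle H
  | x i j => x i j
  | y n i => y (-n) i
  | z n h i => z (-n) h⁻¹ i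
  | e n h => e (-n) h⁻¹

/-- The product of two arrows over the same unit; the last clause is never used for such. -/
protected def product : Bundle H → Bundle H → Bundle H
  | x i j, x _ _ => x i j
  | y n i, y m _ => y (n + m) i
  | z n h i, z m k _ => z (n + m) (h * k) i
  | e n h, e m k => e (n + m) (h * k)
  | a, _ => a

instance : ArrowGroupoid (Bundle H) where
  src := unit
  rng := unit
  inv := Bundle.inverse
  mul := Bundle.product
  src_src a := by cases a <;> rfl
  rng_src a := by cases a <;> rfl
  src_rng a := by cases a <;> rfl
  rng_rng a := by cases a <;> rfl
  src_inv a := by cases a <;> rfl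
  rng_inv a := by cases a <;> rfl
  src_mul a b h := by cases a <;> cases b <;> simp_all [unit, Bundle.product]
  rng_mul a b h := by cases a <;> cases b <;> simp_all [unit, Bundle.product]
  mul_assoc a b c h h' := by
    cases a <;> cases b <;> cases c <;> simp_all [unit, Bundle.product, add_assoc, _root_.mul_assoc]
  mul_src a := by cases a <;> simp [unit, Bundle.product]
  rng_mul_self a := by cases a <;> simp [unit, Bundle.product]
  inv_mul a := by
    cases a <;> simp only [unit, Bundle.product, Bundle.inverse, neg_add_cancel, inv_mul_cancel]
  mul_inv a := by
    cases a <;> simp only [unit, Bundle.product, Bundle.inverse, add_neg_cancel, mul_inv_cancel]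

/-- A set `S` is open if and only if
* for each `y n i ∈ S`, the set `S` contains all but finitely many of the points `x i j`, `j ∈ ℕ`;
* for each `e n h ∈ S`, for all but finitely many `i`, the set `S` contains `y n i`, `z n h i` and
all the `x i j`, `j ∈ ℕ`. -/
instance : TopologicalSpace (Bundle H) where
  IsOpen S := (∀ n i, y n i ∈ S → ∀ᶠ j in atTop, x i j ∈ S) ∧
    ∀ n h, e n h ∈ S → ∀ᶠ i in atTop, y n i ∈ S ∧ z n h i ∈ S ∧ ∀ j, x i j ∈ S
  isOpen_univ := by simp
  isOpen_inter S T hS hT := by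
    refine ⟨fun n i h => ?_, fun n h h' => ?_⟩
    · filter_upwards [hS.1 n i h.1, hT.1 n i h.2] with j h₁ h₂ using ⟨h₁, h₂⟩
    · filter_upwards [hS.2 n h h'.1, hT.2 n h h'.2] with j h₁ h₂
      exact ⟨⟨h₁.1, h₂.1⟩, ⟨h₁.2.1, h₂.2.1⟩, fun k => ⟨h₁.2.2 k, h₂.2.2 k⟩⟩
  isOpen_sUnion 𝒮 h𝒮 := by
    refine ⟨?_, ?_⟩
    · rintro n i ⟨S, hS, h⟩
      filter_upwards [(h𝒮 S hS).1 n i h] with j hj using ⟨S, hS, hj⟩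
    · rintro n h ⟨S, hS, h'⟩
      filter_upwards [(h𝒮 S hS).2 n h h'] with i hi
      exact ⟨⟨S, hS, hi.1⟩, ⟨S, hS, hi.2.1⟩, fun j => ⟨S, hS, hi.2.2 j⟩⟩

theorem isOpen_iff {S : Set (Bundle H)} : IsOpen S ↔
    (∀ n i, y n i ∈ S → ∀ᶠ j in atTop, x i j ∈ S) ∧
    ∀ n h, e n h ∈ S → ∀ᶠ i in atTop, y n i ∈ S ∧ z n h i ∈ S ∧ ∀ j, x i j ∈ S := Iff.rfl

variable (H) in
/-- The set `V = X ∪ Y` of units; as a set of arrows it consists of the identity arrows over `X ∪ Y`. -/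
def V : Set (Bundle H) := {γ | (∃ i j, γ = x i j) ∨ ∃ i, γ = y 0 i}

variable (H) in
/-- The set `F = Z ∪ {ε}` of units. -/
def F : Set (Bundle H) := {γ | (∃ i, γ = z 0 1 i) ∨ γ = e 0 1}

theorem isInvariant (W : Set (Bundle H)) : GroupoidCStar.IsInvariant W := fun _ => Iff.rfl

theorem isOpen_V : IsOpen {γ : Bundle H | src γ ∈ V H ∧ rng γ ∈ V H} := by
  rw [isOpen_iff]
  refine ⟨fun n i _ => Eventually.of_forall fun j => ⟨Or.inl ⟨i, j, rfl⟩, Or.inl ⟨i, j, rfl⟩⟩, ?_⟩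
  rintro n h ⟨h' | h', -⟩
  · obtain ⟨i, j, h'⟩ := h'
    cases h'
  · obtain ⟨i, h'⟩ := h'
    cases h'

theorem isClosed_F : IsClosed {γ : Bundle H | src γ ∈ F H ∧ rng γ ∈ F H} := by
  have : {γ : Bundle H | src γ ∈ F H ∧ rng γ ∈ F H}ᶜ
      = {γ : Bundle H | src γ ∈ V H ∧ rng γ ∈ V H} := by
    ext γ
    cases γ <;> simp [src, rng, unit, F, V]
  rw [← isOpen_compl_iff, this]
  exact isOpen_V

/-- The isolated arrows. -/
def isolated : Set (Bundle H) := {γ | (∃ i j, γ = x i j) ∨ ∃ n h i, γ = z n h i}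

theorem isOpen_singleton_of_isolated (γ : Bundle H) (hγ : γ ∈ isolated (H := H)) :
    IsOpen {γ} := by
  rw [isOpen_iff]
  rcases hγ with ⟨i, j, rfl⟩ | ⟨n, h, i, rfl⟩ <;> simp

theorem dense_isolated : Dense (isolated (H := H)) := by
  rw [dense_iff_inter_open]
  rintro U hU ⟨γ, hγ⟩
  rw [isOpen_iff] at hU
  cases γ with
  | x i j => exact ⟨_, hγ, Or.inl ⟨i, j, rfl⟩⟩
  | y n i =>
    obtain ⟨j, hj⟩ := (hU.1 n i hγ).exists
    exact ⟨_, hj, Or.inl ⟨i, j, rfl⟩⟩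
  | z n h i => exact ⟨_, hγ, Or.inr ⟨n, h, i, rfl⟩⟩
  | e n h =>
    obtain ⟨i, hi⟩ := (hU.2 n h hγ).exists
    exact ⟨_, hi.2.1, Or.inr ⟨n, h, i, rfl⟩⟩

theorem isolated_of_src (γ β : Bundle H) (hγ : γ ∈ isolated (H := H)) (h : src β = src γ) :
    β ∈ isolated (H := H) := by
  rcases hγ with ⟨i, j, rfl⟩ | ⟨n, k, i, rfl⟩ <;> cases β <;>
    simp_all [src, unit, isolated]

theorem isolated_rng (γ : Bundle H) (hγ : γ ∈ isolated (H := H)) : rng γ ∈ isolated (H := H) :=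
  isolated_of_src γ _ hγ (src_rng γ)

instance : HasSingularIdeal (Bundle H) :=
  HasSingularIdeal.of_isolated isOpen_singleton_of_isolated dense_isolated isolated_of_src
    isolated_rng

instance : HasSingularIdeal (Reduction (Bundle H) (V H)) := by
  refine HasSingularIdeal.of_isolated
    (D := (Subtype.val ⁻¹' isolated (H := H) : Set (Reduction (Bundle H) (V H)))) ?_ ?_ ?_ ?_
  · intro γ hγ
    have := (isOpen_singleton_of_isolated γ.1 hγ).preimage
      (continuous_subtype_val (p := fun γ : Bundle H => src γ ∈ V H ∧ rng γ ∈ V H))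
    convert this using 1
    ext β
    simp [Subtype.ext_iff]
  · exact dense_isolated.preimage isOpen_V.isOpenMap_subtype_val
  · intro γ β hγ h
    exact isolated_of_src γ.1 β.1 hγ (congrArg Subtype.val h)
  · intro γ hγ
    exact isolated_rng γ.1 hγ

/-! ### The restriction to `F` vanishes on the singular ideal -/

/-- `δ_k ↦ δ_(z k i)` -/
def fibZ (i : ℕ) : ZMod 2 × H ↪ Bundle H := ⟨fun k => z k.1 k.2 i, fun k l h => by
  injection h with h₁ h₂; exact Prod.ext h₁ h₂⟩

/-- `δ_k ↦ δ_(e k)` -/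
def fibE : ZMod 2 × H ↪ Bundle H := ⟨fun k => e k.1 k.2, fun k l h => by
  injection h with h₁ h₂; exact Prod.ext h₁ h₂⟩

/-- Left translation on `ℤ/2 × H`. -/
def leftShift (k : ZMod 2 × H) : ZMod 2 × H ↪ ZMod 2 × H :=
  ⟨fun l => (k.1 + l.1, k.2 * l.2), fun l m h => by
    have h₁ := congrArg Prod.fst h
    have h₂ := congrArg Prod.snd h
    exact Prod.ext (add_left_cancel h₁) (mul_left_cancel h₂)⟩

/-- Compression of an operator along an injection. -/
def comp₂ {ι κ : Type*} (φ : ι ↪ κ) (T : Ell2 κ →L[ℂ] Ell2 κ) : Ell2 ι →L[ℂ] Ell2 ι :=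
  (push φ).adjoint ∘L T ∘L push φ

theorem comp₂_coeff {ι κ : Type*} (φ : ι ↪ κ) (T : Ell2 κ →L[ℂ] Ell2 κ) (a b : ι) :
    comp₂ φ T (delta b) a = T (delta (φ b)) (φ a) := by
  change (push φ).adjoint (T (push φ (delta b))) a = _
  rw [push_adjoint_apply, push_delta]

theorem range_fibZ (i : ℕ) (γ : Bundle H) : γ ∈ Set.range (fibZ (H := H) i) ↔
    src γ = z 0 1 i := by
  constructor
  · rintro ⟨k, rfl⟩; rfl
  · intro h
    cases γ with
    | z n k j =>
      have : j = i := by injection h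
      exact ⟨(n, k), by rw [← this]; rfl⟩
    | x => cases h
    | y => cases h
    | e => cases h

theorem range_fibE (γ : Bundle H) : γ ∈ Set.range (fibE (H := H)) ↔ src γ = e 0 1 := by
  constructor
  · rintro ⟨k, rfl⟩; rfl
  · intro h
    cases γ with
    | e n k => exact ⟨(n, k), rfl⟩
    | x => cases h
    | y => cases h
    | z => cases h

/-- For an injection onto a fibre of the source map, compression is multiplicative. -/
theorem comp₂_mul {φ : ZMod 2 × H ↪ Bundle H} {u : Bundle H}
    (hφ : ∀ γ, γ ∈ Set.range φ ↔ src γ = u)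
    {S T : Ell2 (Bundle H) →L[ℂ] Ell2 (Bundle H)} (hT : T ∈ redCStar (Bundle H)) :
    comp₂ φ (S * T) = comp₂ φ S * comp₂ φ T := by
  refine clm_ext fun b => ?_
  have h : push φ ((push φ).adjoint (T (delta (φ b)))) = T (delta (φ b)) := by
    ext α
    by_cases hα : α ∈ Set.range φ
    · obtain ⟨a, rfl⟩ := hα
      rw [push_apply, push_adjoint_apply]
    · rw [push_apply_of_notMem φ hα]
      refine (apply_eq_zero_of_src_ne ⟨T, hT⟩ ?_).symm
      rw [(hφ (φ b)).1 ⟨b, rfl⟩]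
      exact fun h => hα ((hφ α).2 h)
  change (push φ).adjoint (S (T (push φ (delta b)))) =
    (push φ).adjoint (S (push φ ((push φ).adjoint (T (push φ (delta b))))))
  rw [push_delta, h]

theorem tendsto_z (n : ZMod 2) (h : H) :
    Tendsto (fun i => (z n h i : Bundle H)) atTop (𝓝 (e n h)) := by
  rw [tendsto_nhds]
  intro S hS hmem
  filter_upwards [(isOpen_iff.1 hS).2 n h hmem] with i hi using hi.2.1

theorem eventually_notMem {K : Set (Bundle H)} (hK : IsCompact K) {n : ZMod 2} {h : H}
    (hmem : e n h ∉ K) : ∀ᶠ i in atTop, z n h i ∉ K := by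
  have hC : IsClosed {γ : Bundle H | (∃ i, γ = z n h i) ∨ γ = e n h} := by
    rw [← isOpen_compl_iff, isOpen_iff]
    refine ⟨fun m i _ => by simp, fun m k hk => ?_⟩
    have hk' : ¬ (m = n ∧ k = h) := by simpa using hk
    refine Eventually.of_forall fun i => ⟨by simp, ?_, by simp⟩
    rintro (⟨j, hj⟩ | hj)
    · injection hj with h₁ h₂
      exact hk' ⟨h₁, h₂⟩
    · cases hj
  obtain ⟨t, ht⟩ := (hK.inter_right hC).elim_finite_subcover (fun i => {z n h i})
    (fun i => isOpen_singleton_of_isolated _ (Or.inr ⟨n, h, i, rfl⟩)) (by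
      rintro γ ⟨hγ, ⟨i, rfl⟩ | rfl⟩
      · exact Set.mem_iUnion.2 ⟨i, rfl⟩
      · exact (hmem hγ).elim)
  have hfin : ∀ᶠ i in atTop, i ∉ t := by
    filter_upwards [eventually_gt_atTop (t.sup id)] with i hi hit
    exact absurd (Finset.le_sup (f := id) hit) (not_le.2 hi)
  filter_upwards [hfin] with i hi hmem'
  obtain ⟨j, hj, hj'⟩ := Set.mem_iUnion₂.1 (ht ⟨hmem', Or.inl ⟨i, rfl⟩⟩)
  have : i = j := by injection hj'
  exact hi (this ▸ hj)

theorem tendsto_of_mem_algFunctions {f : Bundle H → ℂ} (hf : f ∈ algFunctions (Bundle H)) :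
    (∀ k : ZMod 2 × H, Tendsto (fun i => f (z k.1 k.2 i)) atTop (𝓝 (f (e k.1 k.2)))) ∧
    ∃ A : Finset (ZMod 2 × H), ∀ k ∉ A, f (e k.1 k.2) = 0 ∧ ∀ i, f (z k.1 k.2 i) = 0 := by
  classical
  induction hf using Submodule.span_induction with
  | mem f hf =>
    obtain ⟨U, hU, hf, K, hKU, hK, hf0⟩ := hf
    refine ⟨fun k => ?_, ?_⟩
    · by_cases hk : e k.1 k.2 ∈ K
      · exact (hf.continuousAt (hU.1.mem_nhds (hKU hk))).tendsto.comp (tendsto_z k.1 k.2)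
      · rw [hf0 _ hk]
        refine tendsto_const_nhds.congr' ?_
        filter_upwards [eventually_notMem hK hk] with i hi using (hf0 _ hi).symm
    · let O : ZMod 2 × H → Set (Bundle H) := fun k => {γ | match γ with
        | x _ _ => True
        | y n _ => n = k.1
        | z n h _ => n = k.1 ∧ h = k.2
        | e n h => n = k.1 ∧ h = k.2}
      have hO : ∀ k, IsOpen (O k) := fun k => by
        rw [isOpen_iff]
        refine ⟨fun n i _ => Eventually.of_forall fun _ => trivial, fun n h hh => ?_⟩
        exact Eventually.of_forall fun i => ⟨hh.1, hh, fun _ => trivial⟩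
      obtain ⟨t, ht⟩ := hK.elim_finite_subcover O hO (by
        rintro γ -
        cases γ with
        | x i j => exact Set.mem_iUnion.2 ⟨(0, 1), trivial⟩
        | y n i => exact Set.mem_iUnion.2 ⟨(n, 1), rfl⟩
        | z n h i => exact Set.mem_iUnion.2 ⟨(n, h), rfl, rfl⟩
        | e n h => exact Set.mem_iUnion.2 ⟨(n, h), rfl, rfl⟩)
      refine ⟨t, fun k hk => ⟨hf0 _ fun h => ?_, fun i => hf0 _ fun h => ?_⟩⟩
      · obtain ⟨l, hl, hl'⟩ := Set.mem_iUnion₂.1 (ht h)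
        have hl' : k.1 = l.1 ∧ k.2 = l.2 := hl'
        exact hk (Prod.ext hl'.1 hl'.2 ▸ hl)
      · obtain ⟨l, hl, hl'⟩ := Set.mem_iUnion₂.1 (ht h)
        have hl' : k.1 = l.1 ∧ k.2 = l.2 := hl'
        exact hk (Prod.ext hl'.1 hl'.2 ▸ hl)
  | zero => exact ⟨fun k => tendsto_const_nhds, ∅, fun k _ => ⟨rfl, fun _ => rfl⟩⟩
  | add f g _ _ hf hg =>
    obtain ⟨hf, A, hA⟩ := hf
    obtain ⟨hg, A', hA'⟩ := hg
    refine ⟨fun k => (hf k).add (hg k), A ∪ A', fun k hk => ?_⟩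
    rw [Finset.notMem_union] at hk
    refine ⟨?_, fun i => ?_⟩
    · rw [Pi.add_apply, (hA k hk.1).1, (hA' k hk.2).1, add_zero]
    · rw [Pi.add_apply, (hA k hk.1).2, (hA' k hk.2).2, add_zero]
  | smul c f _ hf =>
    obtain ⟨hf, A, hA⟩ := hf
    refine ⟨fun k => (hf k).const_mul c, A, fun k hk => ⟨?_, fun i => ?_⟩⟩
    · rw [Pi.smul_apply, (hA k hk).1, smul_zero]
    · rw [Pi.smul_apply, (hA k hk).2, smul_zero]

theorem comp₂_eq_sum {T : Ell2 (Bundle H) →L[ℂ] Ell2 (Bundle H)} (φ : ZMod 2 × H ↪ Bundle H)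
    (c : ZMod 2 × H → ℂ) (A : Finset (ZMod 2 × H)) (hA : ∀ k ∉ A, c k = 0)
    (hT : ∀ a b, T (delta (φ b)) (φ a) = c (a.1 - b.1, a.2 * b.2⁻¹)) :
    comp₂ φ T = ∑ k ∈ A, c k • push (leftShift k) := by
  classical
  refine clm_eq fun a b => ?_
  rw [comp₂_coeff, hT]
  have h : ((∑ k ∈ A, c k • push (leftShift k)) (delta b) : Ell2 (ZMod 2 × H)) a
      = ∑ k ∈ A, c k * (if a = leftShift k b then 1 else 0) := by
    rw [sum_apply, lp.coeFn_sum, Finset.sum_apply]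
    refine Finset.sum_congr rfl fun k _ => ?_
    change c k * (push (leftShift k) (delta b) : Ell2 (ZMod 2 × H)) a = _
    rw [push_delta, delta_apply]
    congr
  rw [h]
  have h' : ∀ k, a = leftShift k b ↔ k = (a.1 - b.1, a.2 * b.2⁻¹) := by
    intro k
    constructor
    · rintro rfl
      refine Prod.ext ?_ ?_
      · change k.1 = k.1 + b.1 - b.1
        simp
      · change k.2 = k.2 * b.2 * b.2⁻¹
        simp
    · rintro rfl
      refine Prod.ext ?_ ?_
      · change a.1 = a.1 - b.1 + b.1
        simp
      · change a.2 = a.2 * b.2⁻¹ * b.2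
        simp
  simp only [h', mul_ite, mul_one, mul_zero, Finset.sum_ite_eq']
  split_ifs with hk
  · rfl
  · exact hA _ hk

theorem comp₂_norm_le {ι κ : Type*} (φ : ι ↪ κ) (T : Ell2 κ →L[ℂ] Ell2 κ) :
    ‖comp₂ φ T‖ ≤ ‖T‖ := by
  have h₁ : ‖push φ‖ ≤ 1 := LinearIsometry.norm_toContinuousLinearMap_le _
  have h₂ : ‖(push φ).adjoint‖ ≤ 1 := (LinearIsometryEquiv.norm_map _ _).trans_le h₁
  calc ‖comp₂ φ T‖ ≤ ‖(push φ).adjoint‖ * (‖T‖ * ‖push φ‖) :=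
        (ContinuousLinearMap.opNorm_comp_le _ _).trans
          (mul_le_mul_of_nonneg_left (ContinuousLinearMap.opNorm_comp_le _ _) (norm_nonneg _))
    _ ≤ 1 * (‖T‖ * 1) := by gcongr
    _ = ‖T‖ := by ring

theorem comp₂_add {ι κ : Type*} (φ : ι ↪ κ) (S T : Ell2 κ →L[ℂ] Ell2 κ) :
    comp₂ φ (S + T) = comp₂ φ S + comp₂ φ T := by
  ext1 x; simp [comp₂]

theorem comp₂_sub {ι κ : Type*} (φ : ι ↪ κ) (S T : Ell2 κ →L[ℂ] Ell2 κ) :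
    comp₂ φ (S - T) = comp₂ φ S - comp₂ φ T := by
  ext1 x; simp [comp₂]

theorem comp₂_smul {ι κ : Type*} (φ : ι ↪ κ) (c : ℂ) (T : Ell2 κ →L[ℂ] Ell2 κ) :
    comp₂ φ (c • T) = c • comp₂ φ T := by
  ext1 x; simp [comp₂]

theorem comp₂_star {ι κ : Type*} (φ : ι ↪ κ) (T : Ell2 κ →L[ℂ] Ell2 κ) :
    comp₂ φ (star T) = star (comp₂ φ T) := by
  simp only [comp₂, ContinuousLinearMap.star_eq_adjoint, ContinuousLinearMap.adjoint_comp,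
    ContinuousLinearMap.adjoint_adjoint, ContinuousLinearMap.comp_assoc]

theorem comp₂_tendsto {T : Ell2 (Bundle H) →L[ℂ] Ell2 (Bundle H)} (hT : T ∈ redCStar (Bundle H)) :
    Tendsto (fun i => comp₂ (fibZ i) T) atTop (𝓝 (comp₂ fibE T)) := by
  have hadj : ∀ T ∈ NonUnitalStarAlgebra.adjoin ℂ
      {T : Ell2 (Bundle H) →L[ℂ] Ell2 (Bundle H) | ∃ f ∈ algFunctions (Bundle H), IsRegular f T},
      Tendsto (fun i => comp₂ (fibZ i) T) atTop (𝓝 (comp₂ fibE T)) := by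
    intro T hT
    induction hT using NonUnitalStarAlgebra.adjoin_induction with
    | mem T hT =>
      obtain ⟨f, hf, hT⟩ := hT
      obtain ⟨hlim, A, hA⟩ := tendsto_of_mem_algFunctions hf
      have h₁ : ∀ i, comp₂ (fibZ i) T = ∑ k ∈ A, f (z k.1 k.2 i) • push (leftShift k) := fun i =>
        comp₂_eq_sum (fibZ i) (fun k => f (z k.1 k.2 i)) A (fun k hk => (hA k hk).2 i)
          fun a b => by
            refine (hT _ _).trans ((if_pos rfl).trans ?_)
            rw [sub_eq_add_neg]
            rfl
      have h₂ : comp₂ fibE T = ∑ k ∈ A, f (e k.1 k.2) • push (leftShift k) :=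
        comp₂_eq_sum fibE (fun k => f (e k.1 k.2)) A (fun k hk => (hA k hk).1)
          fun a b => by
            refine (hT _ _).trans ((if_pos rfl).trans ?_)
            rw [sub_eq_add_neg]
            rfl
      simp only [h₁, h₂]
      exact tendsto_finsetSum _ fun k _ => (hlim k).smul_const _
    | add S T _ _ hS hT => simp only [comp₂_add]; exact hS.add hT
    | zero =>
      have : ∀ φ : ZMod 2 × H ↪ Bundle H, comp₂ φ 0 = 0 := fun φ => by ext1 x; simp [comp₂]
      simp only [this]; exact tendsto_const_nhds
    | mul S T _ hT' hS hT =>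
      have hT' : T ∈ redCStar (Bundle H) := NonUnitalStarSubalgebra.le_topologicalClosure _ hT'
      simp only [comp₂_mul (range_fibZ _) hT', comp₂_mul range_fibE hT']
      exact hS.mul hT
    | smul c T _ hT => simp only [comp₂_smul]; exact hT.const_smul c
    | star T _ hT => simp only [comp₂_star]; exact hT.star
  rw [Metric.tendsto_atTop]
  intro ε hε
  obtain ⟨S, hS, hTS⟩ := Metric.mem_closure_iff.1 (show T ∈ closure _ from hT) (ε / 3) (by linarith)
  obtain ⟨N, hN⟩ := Metric.tendsto_atTop.1 (hadj S hS) (ε / 3) (by linarith)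
  refine ⟨N, fun i hi => ?_⟩
  have hd : ∀ φ : ZMod 2 × H ↪ Bundle H, dist (comp₂ φ T) (comp₂ φ S) < ε / 3 := fun φ => by
    rw [dist_eq_norm, ← comp₂_sub]
    exact (comp₂_norm_le φ _).trans_lt (by rwa [← dist_eq_norm])
  calc dist (comp₂ (fibZ i) T) (comp₂ fibE T)
      ≤ dist (comp₂ (fibZ i) T) (comp₂ (fibZ i) S) + dist (comp₂ (fibZ i) S) (comp₂ fibE S)
        + dist (comp₂ fibE S) (comp₂ fibE T) := dist_triangle4 _ _ _ _
    _ < ε / 3 + ε / 3 + ε / 3 := by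
        have h₁ := hd (fibZ i)
        have h₂ := hN i hi
        have h₃ := hd fibE
        rw [dist_comm] at h₃
        linarith
    _ = ε := by ring

theorem restrRed_eq_zero (a : redCStar (Bundle H)) (ha : IsSingular a) :
    restrRed (F H) isClosed_F (isInvariant _) a = 0 := by
  have h₁ := (isSingular_iff isOpen_singleton_of_isolated dense_isolated isolated_of_src
    isolated_rng a).1 ha
  have hz : ∀ i, comp₂ (fibZ i) a.1 = 0 := by
    intro i
    refine clm_ext fun b => ?_
    change (push _).adjoint (a.1 (push _ (delta b))) = 0
    rw [push_delta, h₁ (fibZ i b) (Or.inr ⟨b.1, b.2, i, rfl⟩), map_zero]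
  have he : comp₂ fibE a.1 = 0 := by
    refine tendsto_nhds_unique (comp₂_tendsto a.2) ?_
    simp only [hz]
    exact tendsto_const_nhds
  refine Subtype.ext (clm_eq fun α β => ?_)
  change (extOp (F H)).adjoint (a.1 (extOp (F H) (delta β))) α = 0
  rw [extOp_delta, extOp_adjoint_apply]
  obtain ⟨β, hβ, hβ'⟩ := β
  cases β with
  | x i j => simp [src, unit, F] at hβ
  | y n i => simp [src, unit, F] at hβ
  | z n h i => rw [h₁ _ (Or.inr ⟨n, h, i, rfl⟩)]; rfl
  | e n h =>
    by_cases hs : src α.1 = e 0 1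
    · obtain ⟨k, hk⟩ := (range_fibE α.1).2 hs
      have := comp₂_coeff fibE a.1 k (n, h)
      rw [he, hk] at this
      exact this.symm
    · exact apply_eq_zero_of_src_ne a hs

variable (H) in
/-- `C*_r(𝒢_V) → C*_r(𝒢)` -/
def inclV : redCStar (Reduction (Bundle H) (V H)) →⋆ₙₐ[ℂ] redCStar (Bundle H) :=
  inclRed (V H) isOpen_V (isInvariant _)

variable (H) in
/-- `C*_r(𝒢) → C*_r(𝒢_F)` -/
def restrF : redCStar (Bundle H) →⋆ₙₐ[ℂ] redCStar (Reduction (Bundle H) (F H)) :=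
  restrRed (F H) isClosed_F (isInvariant _)

variable (H) in
/-- `C*_ess(𝒢_V) → C*_ess(𝒢)` -/
def inclVEss : EssCStar (Reduction (Bundle H) (V H)) →⋆ₙₐ[ℂ] EssCStar (Bundle H) :=
  inclEss (V H) isOpen_V (isInvariant _)

variable (H) in
/-- `C*_ess(𝒢) → C*_r(𝒢_F)`, induced by the restriction `C*_r(𝒢) → C*_r(𝒢_F)`. -/
def restrFEss : EssCStar (Bundle H) →⋆ₙₐ[ℂ] redCStar (Reduction (Bundle H) (F H)) :=
  (singularIdeal (Bundle H)).lift (restrF H) restrRed_eq_zero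

end Bundle

/-- A (discrete) group is amenable if it has a left invariant finitely additive probability measure
defined on all of its subsets. -/
def IsAmenable (H : Type*) [Group H] : Prop :=
  ∃ m : Set H → ℝ, (∀ A, 0 ≤ m A) ∧ m Set.univ = 1 ∧
    (∀ A B, Disjoint A B → m (A ∪ B) = m A + m B) ∧
    ∀ (h : H) (A : Set H), m ((fun k => h * k) '' A) = m A

end BundleExample

end

/-! The operator attached to $\chi_B$ is the orthogonal projection $P$ = `redProj (V H)` of
$\ell^2(\mathcal G)$ onto the span of the arrows over $V$. Two things have to be shown: $P$ lies in
$C^*_r(\mathcal G)$, which is where non-amenability enters, and its class does not come from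
$\mathcal G_V$.

Membership. For $h\in H$ the set `bisection h`, a copy of the unit space with its part over $F$
translated by $h$, is a compact open bisection. Its characteristic function acts on $\ell^2(\mathcal
G)$ as the unitary `shiftOp h`, which is the identity over $V$ and a multiple of left translation by
$h$ over $F$. An average $T$ = `avgOp S` therefore splits as $P+(T-P)$ with orthogonal summands. If
$\|T-P\|<1$ for some finite $S$, then $T^n\to P$ in norm and $P\in C^*_r(\mathcal G)$
(`redProj_mem_of_norm_lt`). If $\|T-P\|\ge 1$ for every $S$, uniform convexity yields almost unit
vectors over $F$ that are almost invariant under any prescribed finite set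
(`exists_almost_invariant`), and a limit of their mass distributions over $H$ is an invariant mean
(`isAmenable_of_almost_invariant`).

Non-lifting. The units $x_{i0}$ are isolated with trivial isotropy, so evaluation there is a
character of $C^*_r(\mathcal G)$, and it kills the singular ideal. Extended to the unitization and
composed with the matrix trace, it gives a homomorphism on $K$-theory with value $1$ on $[\chi_B]_0$
for every $i$. In $\mathcal G_V$ the points $x_{i0}$ leave every compact set as $i\to\infty$, since
$\epsilon\notin V$; so on the image of $C^*_r(\mathcal G_V)$ these characters tend to $0$, and on
the unitization they tend to the scalar part, whose trace vanishes on $K_0$ (`K₀.mk_notMem_range`).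
A class from $\mathcal G_V$ would thus force $1\to 0$. On the other side $P$ restricts to $0$ on
$F$, so its class dies in $K_0(C^*_r(\mathcal G_F))$. The same argument serves the reduced and the
essential algebras. -/

noncomputable section

/-! ### Numerical invariants of K-theory classes obtained from characters. -/

namespace KTheory

section Trace

variable {B C : Type*} [Ring B] [StarRing B] [Algebra ℂ B] [Ring C] [StarRing C] [Algebra ℂ C]

/-- The target ℂ is commutative, so the trace is cyclic there, even for the rectangular matrices $v$
and $v^*$. -/
theorem trace_map_eq_of_matEquiv (φ : B →⋆ₐ[ℂ] ℂ) {m n : ℕ} {P : Matrix (Fin m) (Fin m) B}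
    {Q : Matrix (Fin n) (Fin n) B} (h : MatEquiv P Q) :
    (P.map φ).trace = (Q.map φ).trace := by
  obtain ⟨v, rfl, rfl⟩ := h
  rw [Matrix.map_mul, Matrix.map_mul, Matrix.trace_mul_comm]

/-- The rank of a projection after the application of a character, computed as a trace. -/
def MvNSemigroup.trace (φ : B →⋆ₐ[ℂ] ℂ) : MvNSemigroup B →+ ℂ where
  toFun := Quotient.lift (fun p => (p.mat.map φ).trace) fun _ _ h => trace_map_eq_of_matEquiv φ h
  map_zero' := Matrix.trace_fin_zero _
  map_add' a b := by
    obtain ⟨m, P, hP, rfl⟩ := exists_rep a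
    obtain ⟨n, Q, hQ, rfl⟩ := exists_rep b
    change ((dsum P Q).map φ).trace = (P.map φ).trace + (Q.map φ).trace
    simp [Matrix.trace, dsum, Fin.sum_univ_add]

theorem MvNSemigroup.trace_mk (φ : B →⋆ₐ[ℂ] ℂ) {n : ℕ} (P : Matrix (Fin n) (Fin n) B)
    (hP : IsStarProjection P) : MvNSemigroup.trace φ (MvNSemigroup.mk P hP) = ∑ i, φ (P i i) :=
  rfl

/-- The homomorphism `K00 B → ℂ` induced by a character of `B`. -/
def K00.trace (φ : B →⋆ₐ[ℂ] ℂ) : K00 B →+ ℂ :=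
  Algebra.GrothendieckAddGroup.lift (MvNSemigroup.trace φ)

theorem K00.trace_of (φ : B →⋆ₐ[ℂ] ℂ) (a : MvNSemigroup B) :
    K00.trace φ (Algebra.GrothendieckAddGroup.of a) = MvNSemigroup.trace φ a :=
  DFunLike.congr_fun (Algebra.GrothendieckAddGroup.lift.symm_apply_apply
    (MvNSemigroup.trace φ)) a

theorem K00.trace_mk (φ : B →⋆ₐ[ℂ] ℂ) (p : B) (hp : IsStarProjection p) :
    K00.trace φ (K00.mk p hp) = φ p := by
  rw [K00.mk, K00.trace_of, MvNSemigroup.trace_mk]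
  simp

theorem K00.trace_map (ψ : C →⋆ₐ[ℂ] ℂ) (φ : B →⋆ₐ[ℂ] C) (a : K00 B) :
    K00.trace ψ (K00.map φ a) = K00.trace (ψ.comp φ) a := by
  suffices h : (K00.trace ψ).comp (K00.map φ) = K00.trace (ψ.comp φ) from DFunLike.congr_fun h a
  refine Algebra.GrothendieckAddGroup.lift.symm.injective ?_
  ext a
  obtain ⟨m, P, hP, rfl⟩ := MvNSemigroup.exists_rep a
  simp only [Algebra.GrothendieckAddGroup.lift_symm_apply, AddMonoidHom.comp_apply, K00.map_of,
    K00.trace_of]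
  rfl

omit [Algebra ℂ B] in
theorem K00.exists_eq_sub (a : K00 B) : ∃ b c : MvNSemigroup B,
    a = Algebra.GrothendieckAddGroup.of b - Algebra.GrothendieckAddGroup.of c := by
  obtain ⟨⟨b, c⟩, h⟩ := (AddLocalization.addMonoidOf (⊤ : AddSubmonoid (MvNSemigroup B))).surj a
  exact ⟨b, c.1, eq_sub_of_add_eq h⟩

/-- A class is a difference of two projections, and each trace is a finite sum of values of the
character on diagonal entries. Hence pointwise convergence of characters is enough. -/
theorem K00.trace_tendsto {φ : ℕ → B →⋆ₐ[ℂ] ℂ} {ψ : B →⋆ₐ[ℂ] ℂ}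
    (h : ∀ b, Filter.Tendsto (fun i => φ i b) Filter.atTop (nhds (ψ b))) (a : K00 B) :
    Filter.Tendsto (fun i => K00.trace (φ i) a) Filter.atTop (nhds (K00.trace ψ a)) := by
  have key : ∀ b : MvNSemigroup B, Filter.Tendsto (fun i => MvNSemigroup.trace (φ i) b)
      Filter.atTop (nhds (MvNSemigroup.trace ψ b)) := fun b => by
    obtain ⟨n, P, hP, rfl⟩ := MvNSemigroup.exists_rep b
    simp only [MvNSemigroup.trace_mk]
    exact tendsto_finsetSum _ fun i _ => h _
  obtain ⟨b, c, rfl⟩ := K00.exists_eq_sub a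
  simp only [map_sub, K00.trace_of]
  exact (key b).sub (key c)

end Trace

section NonUnital

variable {A : Type*} [NonUnitalRing A] [StarRing A] [Module ℂ A] [IsScalarTower ℂ A A]
  [SMulCommClass ℂ A A] [StarModule ℂ A]
variable {A' : Type*} [NonUnitalRing A'] [StarRing A'] [Module ℂ A'] [IsScalarTower ℂ A' A']
  [SMulCommClass ℂ A' A'] [StarModule ℂ A']

theorem K₀.map_mk_eq_zero (φ : A →⋆ₙₐ[ℂ] A') {p : A} (hp : IsStarProjection p)
    (h : φ p = 0) : K₀.map φ (K₀.mk p hp) = 0 := by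
  refine Subtype.ext ?_
  change K00.map _ (Algebra.GrothendieckAddGroup.of _) = 0
  rw [K00.map_of, ← map_zero Algebra.GrothendieckAddGroup.of]
  congr 1
  -- The witness `0` is a matrix with one row and no columns: it links the zero projection of size
  -- one to the empty projection, which represents zero.
  refine MvNSemigroup.sound ⟨0, ?_, ?_⟩
  · refine Matrix.ext fun i j => Eq.symm ?_
    change Unitization.starMap φ (Unitization.inr p) = _
    simp [h]
  · simp

theorem K₀.trace_mk (ψ : Unitization ℂ A →⋆ₐ[ℂ] ℂ) {p : A} (hp : IsStarProjection p) :
    K00.trace ψ (K₀.mk p hp).1 = ψ (Unitization.inr p) :=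
  K00.trace_mk ψ (Unitization.inr p) ⟨by rw [IsIdempotentElem, ← Unitization.inr_mul, hp.1.eq],
    by rw [IsSelfAdjoint, ← Unitization.inr_star, hp.2.star_eq]⟩

omit [StarModule ℂ A] in
theorem starLift_apply (χ : A →⋆ₙₐ[ℂ] ℂ) (r : ℂ) (a : A) :
    Unitization.starLift χ (Unitization.inl r + Unitization.inr a) = r + χ a := by
  have h : Unitization.starLift χ (Unitization.inl r + Unitization.inr a)
      = (r + 0) + χ (0 + a) := rfl
  rw [h, add_zero, zero_add]

/-- A projection of rank one at infinitely many characters that vanish asymptotically on the image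
of `φ` has a class in `K₀` outside of the image of `K₀(φ)`. -/
theorem K₀.mk_notMem_range (φ : A →⋆ₙₐ[ℂ] A') {p : A'} (hp : IsStarProjection p)
    (χ : ℕ → A' →⋆ₙₐ[ℂ] ℂ) (h₁ : ∀ i, χ i p = 1)
    (h₀ : ∀ a, Filter.Tendsto (fun i => χ i (φ a)) Filter.atTop (nhds 0)) :
    K₀.mk p hp ∉ Set.range (K₀.map φ) := by
  rintro ⟨a, ha⟩
  -- The unital extensions of `χ i ∘ φ` converge to the scalar part, because their values on the
  -- non-unital summand tend to zero.
  have hlim := K00.trace_tendsto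
    (φ := fun i => (Unitization.starLift (χ i)).comp (Unitization.starMap φ))
    (ψ := scalarPart A) (fun b => by
      induction b using Unitization.ind with
      | inl_add_inr r b =>
        -- The value is kept in the form `r + 0`, which is the limit that `const_add` produces.
        have : scalarPart A (Unitization.inl r + Unitization.inr b) = r + 0 := rfl
        rw [this]
        have h : ∀ i, (Unitization.starLift (χ i)).comp (Unitization.starMap φ)
            (Unitization.inl r + Unitization.inr b) = r + χ i (φ b) := fun i => by
          rw [StarAlgHom.comp_apply, map_add, Unitization.starMap_inl, Unitization.starMap_inr]
          exact starLift_apply (χ i) r (φ b)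
        simp only [h]
        exact (h₀ b).const_add r) a.1
  -- The trace along `scalarPart A` factors through `K00 ℂ`, where elements of `K₀ A` vanish by
  -- definition.
  have hker : K00.trace (scalarPart A) a.1 = 0 := by
    have h : K00.map (scalarPart A) a.1 = 0 := a.2
    have h' := K00.trace_map (StarAlgHom.id ℂ ℂ) (scalarPart A) a.1
    rw [h, map_zero] at h'
    exact h'.symm
  have hone : ∀ i, K00.trace ((Unitization.starLift (χ i)).comp (Unitization.starMap φ)) a.1
      = 1 := fun i => by
    have h : K00.map (Unitization.starMap φ) a.1 = (K₀.mk p hp).1 := congrArg Subtype.val ha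
    rw [← K00.trace_map, h, K₀.trace_mk]
    have := starLift_apply (χ i) 0 p
    rwa [Unitization.inl_zero, zero_add, zero_add, h₁] at this
  simp only [hone, hker] at hlim
  exact one_ne_zero (tendsto_nhds_unique tendsto_const_nhds hlim)

end NonUnital

end KTheory

namespace BundleExample

open GroupoidCStar ArrowGroupoid Filter Topology

namespace Bundle

variable {H : Type*} [Group H]

/-! ### Evaluation at the points of `X` -/

/-- The only arrow with source `x i j` is `x i j` itself, and elements of the reduced algebra
preserve source fibres, so the basis vector is an eigenvector. This is what makes evaluation at `x i
j` multiplicative. -/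
theorem apply_delta_x (a : redCStar (Bundle H)) (i j : ℕ) :
    a.1 (delta (x i j)) = evalFun a (x i j) • delta (x i j) := by
  ext γ
  rw [lp.coeFn_smul, Pi.smul_apply, delta_apply]
  split_ifs with h
  · subst h
    rw [smul_eq_mul, mul_one]
    rfl
  · rw [smul_zero]
    refine apply_eq_zero_of_src_ne a fun h' => h ?_
    cases γ <;> simp_all [src, unit]

/-- Evaluation at the unit `x i j`. -/
def evalX (i j : ℕ) : redCStar (Bundle H) →⋆ₙₐ[ℂ] ℂ where
  toFun a := evalFun a (x i j)
  map_smul' c a := rfl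
  map_zero' := rfl
  map_add' a b := rfl
  map_mul' a b := by
    change a.1 (b.1 (delta (x i j))) (x i j) = _
    rw [apply_delta_x, map_smul, lp.coeFn_smul, Pi.smul_apply, smul_eq_mul, mul_comm]
    rfl
  map_star' a := by
    change (star a.1) (delta (x i j)) (x i j) = star (a.1 (delta (x i j)) (x i j))
    rw [← inner_delta, ContinuousLinearMap.star_eq_adjoint,
      ContinuousLinearMap.adjoint_inner_right, ← inner_conj_symm, inner_delta]
    rfl

/-- Singular elements annihilate the basis vectors of isolated arrows, so the evaluations descend to
the essential algebra. -/
theorem evalX_eq_zero (i j : ℕ) (a : redCStar (Bundle H)) (ha : IsSingular a) :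
    evalX i j a = 0 := by
  have h := (isSingular_iff isOpen_singleton_of_isolated dense_isolated isolated_of_src
    isolated_rng a).1 ha (x i j) (Or.inl ⟨i, j, rfl⟩)
  change a.1 (delta (x i j)) (x i j) = 0
  rw [h]
  rfl

/-- Evaluation at the unit `x i j`, on the essential C*-algebra. -/
def evalXEss (i j : ℕ) : EssCStar (Bundle H) →⋆ₙₐ[ℂ] ℂ :=
  (singularIdeal (Bundle H)).lift (evalX i j) (evalX_eq_zero i j)

/-- The point `x i j` in the reduction to `V`. -/
def xV (i j : ℕ) : Reduction (Bundle H) (V H) :=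
  ⟨x i j, Or.inl ⟨i, j, rfl⟩, Or.inl ⟨i, j, rfl⟩⟩

/-- The arrows of the reduction to `V` over `X i ∪ {y i}`. -/
def piece (i : ℕ) : Set (Reduction (Bundle H) (V H)) :=
  {γ | (∃ j, γ.1 = x i j) ∨ ∃ n, γ.1 = y n i}

theorem isOpen_piece (i : ℕ) : IsOpen (piece (H := H) i) := by
  have h : IsOpen {γ : Bundle H | (∃ j, γ = x i j) ∨ ∃ n, γ = y n i} := by
    rw [isOpen_iff]
    refine ⟨fun n k hk => ?_, fun n h hn => by simp at hn⟩
    have : k = i := by simpa [eq_comm] using hk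
    exact Eventually.of_forall fun j => Or.inl ⟨j, by rw [this]⟩
  exact h.preimage continuous_subtype_val

theorem exists_mem_piece (γ : Reduction (Bundle H) (V H)) : ∃ i, γ ∈ piece i := by
  obtain ⟨γ, hγ, -⟩ := γ
  cases γ with
  | x i j => exact ⟨i, Or.inl ⟨j, rfl⟩⟩
  | y n i => exact ⟨i, Or.inr ⟨n, rfl⟩⟩
  | z n h i => simp [src, unit, V] at hγ
  | e n h => simp [src, unit, V] at hγ

/-- The sets `piece i` form an open cover of the reduction to $V$, and `xV i 0` lies in no piece but
the $i$-th; a compact set is covered by finitely many of them. In the whole bundle this fails, since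
there the points `x i 0` converge to the arrows over $\epsilon$. -/
theorem eventually_xV_notMem {K : Set (Reduction (Bundle H) (V H))} (hK : IsCompact K) :
    ∀ᶠ i in atTop, xV i 0 ∉ K := by
  obtain ⟨t, ht⟩ := hK.elim_finite_subcover piece isOpen_piece fun γ _ =>
    Set.mem_iUnion.2 (exists_mem_piece γ)
  filter_upwards [eventually_gt_atTop (t.sup id)] with i hi hmem
  obtain ⟨k, hk, hk'⟩ := Set.mem_iUnion₂.1 (ht hmem)
  have : i = k := by
    rcases hk' with ⟨j, hj⟩ | ⟨n, hn⟩
    · injection hj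
    · cases hn
  exact absurd (Finset.le_sup (f := id) (this ▸ hk)) (not_le.2 hi)

theorem eventually_eq_zero_of_mem_algFunctions {f : Reduction (Bundle H) (V H) → ℂ}
    (hf : f ∈ algFunctions (Reduction (Bundle H) (V H))) : ∀ᶠ i in atTop, f (xV i 0) = 0 := by
  induction hf using Submodule.span_induction with
  | mem f hf =>
    obtain ⟨U, -, -, K, -, hK, hf0⟩ := hf
    filter_upwards [eventually_xV_notMem hK] with i hi using hf0 _ hi
  | zero => exact Eventually.of_forall fun _ => rfl
  | add f g _ _ hf hg =>
    filter_upwards [hf, hg] with i h₁ h₂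
    rw [Pi.add_apply, h₁, h₂, add_zero]
  | smul c f _ hf =>
    filter_upwards [hf] with i h
    rw [Pi.smul_apply, h, smul_zero]

theorem src_eq_xV {γ : Reduction (Bundle H) (V H)} {i j : ℕ} (h : src γ = src (xV i j)) :
    γ = xV i j := by
  have h' : unit γ.1 = x i j := congrArg Subtype.val h
  refine Subtype.ext ?_
  change γ.1 = x i j
  generalize γ.1 = β at h'
  cases β <;> simp_all [unit]

theorem norm_delta {ι : Type*} (i : ι) : ‖(delta i : Ell2 ι)‖ = 1 := orthonormal_delta.1 i

/-- The operators $T$ with $T\delta_{x_{i0}}\to 0$ form a norm closed left ideal, so it suffices to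
treat generators, where the vectors are eventually zero by compactness of supports. -/
theorem tendsto_apply_xV (a : redCStar (Reduction (Bundle H) (V H))) :
    Tendsto (fun i => a.1 (delta (xV i 0))) atTop (𝓝 0) := by
  let S : Set (Ell2 (Reduction (Bundle H) (V H)) →L[ℂ] Ell2 (Reduction (Bundle H) (V H))) :=
    {T | Tendsto (fun i => T (delta (xV i 0))) atTop (𝓝 0)}
  have hS : IsClosed S := by
    rw [← closure_subset_iff_isClosed]
    intro T hT
    change Tendsto _ _ _
    rw [Metric.tendsto_atTop]
    intro ε hε
    obtain ⟨T', hT', hd⟩ := Metric.mem_closure_iff.1 hT (ε / 2) (half_pos hε)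
    obtain ⟨N, hN⟩ := Metric.tendsto_atTop.1 hT' (ε / 2) (half_pos hε)
    refine ⟨N, fun i hi => ?_⟩
    have h₁ := hN i hi
    have h₂ := (T - T').le_opNorm (delta (xV i 0))
    -- The basis vectors have norm one, so approximation in operator norm is uniform in `i`.
    rw [norm_delta, mul_one, ← dist_eq_norm T T', _root_.sub_apply,
      ← dist_eq_norm] at h₂
    calc _ ≤ _ := dist_triangle _ _ _
      _ < ε / 2 + ε / 2 := add_lt_add (h₂.trans_lt hd) h₁
      _ = ε := add_halves ε
  -- The condition is imposed on $T$ and on $T^*$ together to survive the involution. For a product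
  -- $TT'$ it is then inherited from $T'$, and for $(TT')^*=T'^*T^*$ from $T^*$.
  have key : ∀ T ∈ NonUnitalStarAlgebra.adjoin ℂ
      {T : Ell2 (Reduction (Bundle H) (V H)) →L[ℂ] Ell2 (Reduction (Bundle H) (V H)) |
        ∃ f ∈ algFunctions (Reduction (Bundle H) (V H)), IsRegular f T}, T ∈ S ∧ star T ∈ S := by
    intro T hT
    induction hT using NonUnitalStarAlgebra.adjoin_induction with
    | mem T hT =>
      obtain ⟨f, hf, hT⟩ := hT
      -- The fibre over `xV i 0` is a single unit, so the row and the column of $T$ at this unit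
      -- have at most one nonzero entry, namely `f (xV i 0)`.
      have h₀ : ∀ᶠ i in atTop, ∀ γ, T (delta (xV i 0)) γ = 0 ∧ T (delta γ) (xV i 0) = 0 := by
        filter_upwards [eventually_eq_zero_of_mem_algFunctions hf] with i hi γ
        rw [hT, hT]
        constructor
        · split_ifs with h
          · rw [src_eq_xV h, ArrowGroupoid.mul_inv, ← hi]; rfl
          · rfl
        · split_ifs with h
          · rw [src_eq_xV h.symm, ArrowGroupoid.mul_inv, ← hi]; rfl
          · rfl
      constructor
      · refine tendsto_const_nhds.congr' ?_
        filter_upwards [h₀] with i hi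
        ext γ
        exact (hi γ).1.symm
      · refine tendsto_const_nhds.congr' ?_
        filter_upwards [h₀] with i hi
        ext γ
        rw [← inner_delta γ ((star T) _), ContinuousLinearMap.star_eq_adjoint,
          ContinuousLinearMap.adjoint_inner_right, ← inner_conj_symm, inner_delta, (hi γ).2]
        exact (map_zero _).symm
    | add T T' _ _ hT hT' =>
      refine ⟨?_, ?_⟩
      · simpa [S] using Tendsto.add hT.1 hT'.1
      · simpa [S, star_add] using Tendsto.add hT.2 hT'.2
    | zero => simp [S]
    | mul T T' _ _ hT hT' =>
      constructor
      · have := (T.continuous.tendsto 0).comp hT'.1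
        rwa [map_zero] at this
      · have := ((star T').continuous.tendsto 0).comp hT.2
        rw [map_zero] at this
        rw [star_mul]
        exact this
    | smul c T _ hT =>
      refine ⟨?_, ?_⟩
      · simpa [S] using Tendsto.const_smul hT.1 c
      · simpa [S, star_smul] using Tendsto.const_smul hT.2 (star c)
    | star T _ hT => exact ⟨hT.2, by rw [star_star]; exact hT.1⟩
  exact closure_minimal (fun T hT => (key T hT).1) hS a.2

theorem tendsto_evalX_inclV (a : redCStar (Reduction (Bundle H) (V H))) :
    Tendsto (fun i => evalX i 0 (inclV H a)) atTop (𝓝 0) := by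
  have h : ∀ i, evalX i 0 (inclV H a) = a.1 (delta (xV i 0)) (xV i 0) := fun i => by
    have := congrFun (evalFun_inclRed isOpen_V (isInvariant _) a) (x i 0)
    exact this.trans (extFun_val (evalFun a) (xV i 0))
  simp only [h]
  refine squeeze_zero_norm (fun i => ?_) (tendsto_zero_iff_norm_tendsto_zero.1
    (tendsto_apply_xV a))
  exact lp.norm_apply_le_norm two_ne_zero _ _

theorem tendsto_evalXEss_inclVEss (b : EssCStar (Reduction (Bundle H) (V H))) :
    Tendsto (fun i => evalXEss i 0 (inclVEss H b)) atTop (𝓝 0) := by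
  obtain ⟨a, rfl⟩ := StarIdeal.toQuot_surjective b
  -- On the class of `a`, the essential maps unfold to the reduced ones.
  exact tendsto_evalX_inclV a

/-! ### The projection `χ_B` -/

/-- The left action of `H` on the arrows over `F`, extended trivially to the arrows over `V`. -/
def shift (h : H) : Bundle H → Bundle H
  | x i j => x i j
  | y n i => y n i
  | z n k i => z n (h * k) i
  | e n k => e n (h * k)

theorem shift_shift (h k : H) (γ : Bundle H) : shift h (shift k γ) = shift (h * k) γ := by
  cases γ <;> simp [shift, _root_.mul_assoc]

theorem shift_one (γ : Bundle H) : shift 1 γ = γ := by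
  cases γ <;> simp [shift]

/-- The component in $H$ occurs in the openness condition only through `e n k` and `z n k i`, which
are translated simultaneously. -/
theorem continuous_shift (h : H) : Continuous (shift h) := by
  refine ⟨fun S hS => ?_⟩
  rw [isOpen_iff] at hS ⊢
  exact ⟨hS.1, fun n k hk => hS.2 n (h * k) hk⟩

/-- `shift` as a homeomorphism. -/
def shiftHomeo (h : H) : Bundle H ≃ₜ Bundle H where
  toFun := shift h
  invFun := shift h⁻¹
  left_inv γ := by rw [shift_shift, inv_mul_cancel, shift_one]
  right_inv γ := by rw [shift_shift, mul_inv_cancel, shift_one]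
  continuous_toFun := continuous_shift h
  continuous_invFun := continuous_shift h⁻¹

/-- The units of the bundle. -/
def units (H : Type*) [Group H] : Set (Bundle H) := {γ | unit γ = γ}

theorem isOpen_units : IsOpen (units H) := by
  rw [isOpen_iff]
  refine ⟨fun n i _ => Eventually.of_forall fun j => rfl, fun n h hn => ?_⟩
  have hn' : (e 0 1 : Bundle H) = e n h := hn
  injection hn' with h₁ h₂
  subst h₁ h₂
  exact Eventually.of_forall fun i => ⟨rfl, rfl, fun j => rfl⟩

/-- A neighbourhood of $\epsilon$ contains all but finitely many of the blocks $\{z_i,y_i\}\cup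
X_i$, and each block is compact: a sequence with its limit $y_i$, and one more point. -/
theorem isCompact_units : IsCompact (units H) := by
  have hpiece : ∀ i, IsCompact (insert (y 0 i : Bundle H) (Set.range (x i))) := fun i => by
    refine Tendsto.isCompact_insert_range ?_
    rw [tendsto_nhds]
    exact fun S hS hmem => (isOpen_iff.1 hS).1 0 i hmem
  refine isCompact_of_finite_subcover fun {ι} U hU hcover => ?_
  obtain ⟨i₀, h₀⟩ := Set.mem_iUnion.1 (hcover (show (e 0 1 : Bundle H) ∈ units H from rfl))
  -- The member of the cover that contains $\epsilon$ absorbs every block of index at least `N`.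
  obtain ⟨N, hN⟩ := eventually_atTop.1 ((isOpen_iff.1 (hU i₀)).2 0 1 h₀)
  have hK : IsCompact (⋃ i ∈ Finset.range N,
      (insert (z 0 1 i : Bundle H) (insert (y 0 i) (Set.range (x i))))) :=
    (Finset.range N).isCompact_biUnion fun i _ => (hpiece i).insert _
  obtain ⟨t, ht⟩ := hK.elim_finite_subcover U hU ((Set.iUnion₂_subset fun i _ => by
    rintro γ (rfl | rfl | ⟨j, rfl⟩) <;> rfl).trans hcover)
  classical
  refine ⟨insert i₀ t, fun γ hγ => ?_⟩
  rw [Finset.set_biUnion_insert]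
  have hcase : ∀ i, (γ = z 0 1 i ∨ γ = y 0 i ∨ ∃ j, x i j = γ) →
      γ ∈ U i₀ ∪ ⋃ x ∈ t, U x := fun i hi => by
    rcases lt_or_ge i N with h | h
    · refine Or.inr (ht (Set.mem_iUnion₂.2 ⟨i, Finset.mem_range.2 h, ?_⟩))
      exact hi
    · left
      rcases hi with rfl | rfl | ⟨j, rfl⟩
      · exact (hN i h).2.1
      · exact (hN i h).1
      · exact (hN i h).2.2 j
  change unit γ = γ at hγ
  cases γ with
  | x i j => exact hcase i (Or.inr (Or.inr ⟨j, rfl⟩))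
  | y n i => exact hcase i (Or.inr (Or.inl hγ.symm))
  | z n h i => exact hcase i (Or.inl hγ.symm)
  | e n h => exact Or.inl (hγ ▸ h₀)

/-- The bisection of the arrows `shift h u`, for `u` a unit. -/
def bisection (h : H) : Set (Bundle H) := {γ | shift h (unit γ) = γ}

theorem bisection_eq_image (h : H) : bisection h = shiftHomeo h '' units H := by
  ext γ
  constructor
  · intro hγ
    refine ⟨unit γ, ?_, hγ⟩
    cases γ <;> rfl
  · rintro ⟨u, hu, rfl⟩
    change shift h (unit (shift h u)) = shift h u
    change unit u = u at hu
    congr 1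
    cases u <;> exact hu

/-- On this set the source map, which is also the range map, is the restriction of the inverse of
the homeomorphism `shiftHomeo h`. -/
theorem isOpenBisection_bisection (h : H) : IsOpenBisection (bisection h) := by
  have hemb : Topology.IsEmbedding (fun a : bisection h => unit (a : Bundle H)) := by
    have : (fun a : bisection h => unit (a : Bundle H))
        = (shiftHomeo h).symm ∘ (Subtype.val : bisection h → Bundle H) := by
      funext a
      exact ((shiftHomeo h).symm_apply_eq.2 a.2.symm).symm
    rw [this]
    exact (shiftHomeo h).symm.isEmbedding.comp Topology.IsEmbedding.subtypeVal
  refine ⟨?_, hemb, hemb⟩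
  rw [bisection_eq_image]
  exact (shiftHomeo h).isOpenMap _ isOpen_units

/-- The bisection is compact as well as open, so it can serve as the compact support of its own
indicator. -/
theorem indicator_bisection_mem (h : H) :
    Set.indicator (bisection h) (1 : Bundle H → ℂ) ∈ algFunctions (Bundle H) := by
  refine Submodule.subset_span ⟨bisection h, isOpenBisection_bisection h,
    (continuousOn_const (c := (1 : ℂ))).congr fun γ hγ => Set.indicator_of_mem hγ _,
    bisection h, subset_rfl, ?_, fun γ hγ => Set.indicator_of_notMem hγ _⟩
  rw [bisection_eq_image]
  exact isCompact_units.image (shiftHomeo h).continuous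

/-- The unitary operator on `ℓ²(Bundle H)` that is given by `shift h`. -/
def shiftOp (h : H) : Ell2 (Bundle H) →L[ℂ] Ell2 (Bundle H) :=
  push (shiftHomeo h).toEquiv.toEmbedding

theorem shiftOp_delta (h : H) (γ : Bundle H) : shiftOp h (delta γ) = delta (shift h γ) :=
  push_delta _ γ

theorem shiftOp_apply (h : H) (v : Ell2 (Bundle H)) (γ : Bundle H) :
    shiftOp h v γ = v (shift h⁻¹ γ) := by
  have := push_apply (shiftHomeo h).toEquiv.toEmbedding v (shift h⁻¹ γ)
  rw [← this]
  change shiftOp h v γ = shiftOp h v (shift h (shift h⁻¹ γ))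
  rw [shift_shift, mul_inv_cancel, shift_one]

theorem norm_shiftOp (h : H) (v : Ell2 (Bundle H)) : ‖shiftOp h v‖ = ‖v‖ :=
  LinearIsometry.norm_map _ _

theorem shiftOp_isRegular (h : H) :
    IsRegular (Set.indicator (bisection h) 1) (shiftOp h) := by
  classical
  intro α β
  rw [shiftOp_delta, delta_apply]
  by_cases hs : src α = src β
  · rw [if_pos hs, Set.indicator_apply]
    -- Translating by $h$ is left multiplication by the unique arrow of the bisection over the same
    -- unit. The ℤ/2 coordinates have to agree, which is checked in characteristic two.
    have key : α = shift h β ↔ mul α (inv β) ∈ bisection h := by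
      change _ ↔ shift h (unit (Bundle.product α (Bundle.inverse β)))
        = Bundle.product α (Bundle.inverse β)
      change unit α = unit β at hs
      cases α <;> cases β <;>
        simp_all [unit, shift, Bundle.product, Bundle.inverse, eq_mul_inv_iff_mul_eq, eq_comm,
          CharTwo.add_eq_zero]
    by_cases hk : α = shift h β
    · rw [if_pos hk, if_pos (key.1 hk)]; rfl
    · rw [if_neg hk, if_neg fun h' => hk (key.2 h')]
  · rw [if_neg hs, if_neg]
    rintro rfl
    exact hs (by cases β <;> rfl)

theorem shiftOp_mem (h : H) : shiftOp h ∈ redCStar (Bundle H) :=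
  mem_redCStar (indicator_bisection_mem h) (shiftOp_isRegular h)

theorem shift_of_src_mem_V {γ : Bundle H} (hγ : src γ ∈ V H) (h : H) : shift h γ = γ := by
  cases γ <;> simp_all [src, unit, V, shift]

theorem shiftOp_mul_redProj (h : H) : shiftOp h * redProj (V H) = redProj (V H) := by
  refine clm_ext fun γ => ?_
  change shiftOp h (redProj (V H) (delta γ)) = redProj (V H) (delta γ)
  by_cases hγ : src γ ∈ V H ∧ rng γ ∈ V H
  · rw [redProj_delta hγ, shiftOp_delta, shift_of_src_mem_V hγ.1]
  · rw [redProj_delta_of_notMem hγ, map_zero]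

theorem redProj_isStarProjection : IsStarProjection (redProj (V H)) :=
  ⟨ContinuousLinearMap.ext fun _ => redProj_extOp _, redProj_star⟩

/-- The average of the operators `shiftOp h`, for `h ∈ S`. -/
def avgOp (S : Finset H) : Ell2 (Bundle H) →L[ℂ] Ell2 (Bundle H) :=
  (S.card : ℂ)⁻¹ • ∑ h ∈ S, shiftOp h

theorem avgOp_mem (S : Finset H) : avgOp S ∈ redCStar (Bundle H) :=
  SMulMemClass.smul_mem _ (sum_mem fun h _ => shiftOp_mem h)

theorem avgOp_mul_redProj {S : Finset H} (hS : S.Nonempty) :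
    avgOp S * redProj (V H) = redProj (V H) := by
  rw [avgOp, smul_mul_assoc, Finset.sum_mul, Finset.sum_congr rfl fun h _ => shiftOp_mul_redProj h,
    Finset.sum_const, ← Nat.cast_smul_eq_nsmul ℂ, smul_smul,
    inv_mul_cancel₀ (Nat.cast_ne_zero.2 hS.card_ne_zero), one_smul]

theorem redProj_mul_avgOp {S : Finset H} (hS : S.Nonempty) :
    redProj (V H) * avgOp S = redProj (V H) := by
  rw [redProj_comm (isInvariant _) (avgOp_mem S), avgOp_mul_redProj hS]

/-- With respect to $P$ and $1-P$ the average is block diagonal, equal to the identity on the first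
block and a strict contraction on the second. Its powers stay in the closed algebra and converge to
$P$. -/
theorem redProj_mem_of_norm_lt {S : Finset H} (hS : S.Nonempty)
    (h : ‖avgOp S - redProj (V H)‖ < 1) : redProj (V H) ∈ redCStar (Bundle H) := by
  set P := redProj (V H)
  set T := avgOp S
  have hTP : T * P = P := avgOp_mul_redProj hS
  have hPT : P * T = P := redProj_mul_avgOp hS
  have hPP : P * P = P := redProj_isStarProjection.1
  -- Exponents start at one: the formula fails for exponent zero, and the identity operator need not
  -- belong to the algebra.
  have hpow : ∀ n : ℕ, T ^ (n + 1) = P + (T - P) ^ (n + 1) := by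
    intro n
    induction n with
    | zero => simp
    | succ n ih =>
      have h₁ : (T - P) ^ (n + 1) * P = 0 := by
        rw [pow_succ, _root_.mul_assoc, sub_mul, hTP, hPP, sub_self, mul_zero]
      rw [pow_succ, ih, pow_succ (T - P) (n + 1), add_mul, hPT, mul_sub, h₁, sub_zero]
  have hmem : ∀ n : ℕ, T ^ (n + 1) ∈ redCStar (Bundle H) := by
    intro n
    induction n with
    | zero => rw [zero_add, pow_one]; exact avgOp_mem S
    | succ n ih => rw [pow_succ]; exact mul_mem ih (avgOp_mem S)
  have hlim : Tendsto (fun n : ℕ => T ^ (n + 1)) atTop (𝓝 P) := by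
    simp only [hpow]
    simpa using ((tendsto_pow_atTop_nhds_zero_of_norm_lt_one h).comp
      (tendsto_add_atTop_nat 1)).const_add P
  exact isClosed_redCStar.mem_of_tendsto hlim (Eventually.of_forall hmem)

/-- As a function on the groupoid, `redProj V` is the characteristic function of `V`. -/
theorem evalFun_redProj (h : redProj (V H) ∈ redCStar (Bundle H)) :
    evalFun ⟨redProj (V H), h⟩ = Set.indicator (V H) 1 := by
  classical
  ext γ
  change redProj (V H) (delta (src γ)) γ = _
  by_cases hγ : src γ ∈ V H
  · rw [redProj_delta ⟨(src_src γ).symm ▸ hγ, (rng_src γ).symm ▸ hγ⟩, delta_apply,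
      Set.indicator_apply, Pi.one_apply]
    congr 1
    refine propext ?_
    cases γ <;> simp_all [src, unit, V]
  · rw [redProj_delta_of_notMem fun h' => hγ ((src_src γ) ▸ h'.1), Set.indicator_of_notMem]
    · rfl
    · intro h'
      apply hγ
      cases γ <;> simp_all [src, unit, V]

theorem restrF_redProj (h : redProj (V H) ∈ redCStar (Bundle H)) :
    restrF H ⟨redProj (V H), h⟩ = 0 := by
  refine Subtype.ext (clm_ext fun γ => ?_)
  change (extOp (F H)).adjoint (redProj (V H) (extOp (F H) (delta γ))) = 0
  have hγ : ¬ (src γ.1 ∈ V H ∧ rng γ.1 ∈ V H) := by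
    rintro ⟨h', -⟩
    have h'' : src γ.1 ∈ F H := γ.2.1
    generalize γ.1 = β at h' h''
    cases β <;> simp [src, unit, V, F] at h' h''
  rw [extOp_delta, redProj_delta_of_notMem hγ, map_zero]

end Bundle

end BundleExample

/-! ### Mass distributions of vectors in ℓ². -/

namespace BundleExample

open GroupoidCStar ArrowGroupoid Filter Topology

section Mass

variable {ι : Type*}

/-- Restriction of a vector in `ℓ²(ι)` to a subset of `ι`. -/
def restrict (B : Set ι) : Ell2 ι →L[ℂ] Ell2 B :=
  (push (Function.Embedding.subtype (· ∈ B))).adjoint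

theorem restrict_apply (B : Set ι) (v : Ell2 ι) (i : B) : restrict B v i = v i :=
  push_adjoint_apply (Function.Embedding.subtype (· ∈ B)) v i

/-- The squared `ℓ²`-norm of a vector on a subset. -/
def mass (B : Set ι) (v : Ell2 ι) : ℝ := ‖restrict B v‖ ^ 2

theorem hasSum_norm_sq (v : Ell2 ι) : HasSum (fun i => ‖v i‖ ^ 2) (‖v‖ ^ 2) := by
  simpa using lp.hasSum_norm (p := 2) (by simp) v

theorem hasSum_mass (B : Set ι) (v : Ell2 ι) : HasSum (fun i : B => ‖v i‖ ^ 2) (mass B v) := by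
  have := hasSum_norm_sq (restrict B v)
  simp only [restrict_apply] at this
  exact this

theorem norm_restrict_le (B : Set ι) (v : Ell2 ι) : ‖restrict B v‖ ≤ ‖v‖ := by
  have h : ‖restrict B‖ ≤ 1 := (LinearIsometryEquiv.norm_map _ _).trans_le
    (LinearIsometry.norm_toContinuousLinearMap_le _)
  exact ((restrict B).le_of_opNorm_le h v).trans_eq (one_mul _)

theorem mass_nonneg (B : Set ι) (v : Ell2 ι) : 0 ≤ mass B v := sq_nonneg _

theorem mass_le (B : Set ι) (v : Ell2 ι) : mass B v ≤ ‖v‖ ^ 2 :=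
  pow_le_pow_left₀ (norm_nonneg _) (norm_restrict_le B v) 2

theorem mass_union {A B : Set ι} (h : Disjoint A B) (v : Ell2 ι) :
    mass (A ∪ B) v = mass A v + mass B v :=
  (hasSum_mass (A ∪ B) v).unique
    (HasSum.add_disjoint (f := fun i => ‖v i‖ ^ 2) h (hasSum_mass A v) (hasSum_mass B v))

theorem mass_eq_norm_sq {B : Set ι} {v : Ell2 ι} (h : ∀ i ∉ B, v i = 0) :
    mass B v = ‖v‖ ^ 2 := by
  refine (hasSum_mass B v).unique
    ((hasSum_subtype_iff_of_support_subset (f := fun i => ‖v i‖ ^ 2) fun i hi => ?_).2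
      (hasSum_norm_sq v))
  by_contra hB
  simp [h i hB] at hi

/-- A difference of squares; it turns almost invariance of a vector in norm into almost invariance
of its mass, uniformly in the subset. -/
theorem abs_mass_sub_le (B : Set ι) (v w : Ell2 ι) :
    |mass B v - mass B w| ≤ ‖v - w‖ * (‖v‖ + ‖w‖) := by
  rw [mass, mass, sq_sub_sq, abs_mul, mul_comm]
  refine mul_le_mul ?_ ?_ (abs_nonneg _) (norm_nonneg _)
  · refine (abs_norm_sub_norm_le _ _).trans ?_
    rw [← map_sub]
    exact norm_restrict_le _ _
  · rw [abs_of_nonneg (by positivity)]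
    exact add_le_add (norm_restrict_le _ _) (norm_restrict_le _ _)

end Mass

namespace Bundle

variable {H : Type*} [Group H]

/-! ### The spectral gap of a non-amenable group -/

/-- The arrows over `F` with component in `A` along `H`. -/
def overF (A : Set H) : Set (Bundle H) := {γ | ∃ n, ∃ h ∈ A, γ = e n h ∨ ∃ i, γ = z n h i}

omit [Group H] in
theorem disjoint_overF {A B : Set H} (h : Disjoint A B) : Disjoint (overF A) (overF B) := by
  rw [Set.disjoint_left] at h ⊢
  rintro γ ⟨n, k, hk, hγ⟩ ⟨m, l, hl, hγ'⟩
  have : k = l := by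
    rcases hγ with rfl | ⟨i, rfl⟩ <;> rcases hγ' with h' | ⟨j, h'⟩ <;> cases h' <;> rfl
  exact h hk (this ▸ hl)

theorem overF_union (A B : Set H) : overF (A ∪ B) = overF A ∪ overF B := by
  ext γ
  cases γ <;> simp [overF]

theorem src_mem_V_of_notMem_overF {γ : Bundle H} (hγ : γ ∉ overF Set.univ) : src γ ∈ V H := by
  cases γ <;> simp_all [overF, src, unit, V]

/-- A change of variables: `shift k` carries the arrows over $F$ with component in $A$ bijectively
to those with component in $kA$. -/
theorem mass_overF_smul (k : H) (A : Set H) (v : Ell2 (Bundle H)) :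
    mass (overF ((fun h => k * h) '' A)) v = mass (overF A) (shiftOp k⁻¹ v) := by
  have h : ∀ γ, γ ∈ overF A ↔ shiftHomeo k γ ∈ overF ((fun h => k * h) '' A) := by
    intro γ
    change _ ↔ shift k γ ∈ _
    cases γ <;> simp [overF, shift]
  refine (((shiftHomeo k).toEquiv.subtypeEquiv h).hasSum_iff.2 (hasSum_mass _ v)).unique ?_
  convert hasSum_mass (overF A) (shiftOp k⁻¹ v) using 2 with γ
  rw [shiftOp_apply, inv_inv]
  rfl

theorem card_smul_avgOp {S : Finset H} (hS : S.Nonempty) (v : Ell2 (Bundle H)) :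
    (S.card : ℂ) • avgOp S v = ∑ h ∈ S, shiftOp h v := by
  rw [avgOp, _root_.smul_apply, smul_smul, mul_inv_cancel₀ (Nat.cast_ne_zero.2 hS.card_ne_zero),
    one_smul, _root_.sum_apply]

theorem norm_sum_shiftOp_le (S : Finset H) (v : Ell2 (Bundle H)) :
    ‖∑ h ∈ S, shiftOp h v‖ ≤ S.card * ‖v‖ := by
  refine (norm_sum_le _ _).trans_eq ?_
  simp only [norm_shiftOp, Finset.sum_const, nsmul_eq_mul]

/-- Uniform convexity of Hilbert space. If an average of vectors of norm at most one has norm at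
least $1-\delta$, then any two of them have a sum of norm at least $2-|S|\delta$. The parallelogram
law bounds their squared distance by $4-(2-|S|\delta)^2\le 4|S|\delta$. Here the two vectors are the
translates by $s$ and by $1$. -/
theorem norm_shiftOp_sub_sq_le {S : Finset H} (h1 : 1 ∈ S) {s : H} (hs : s ∈ S)
    {v : Ell2 (Bundle H)} (hv : ‖v‖ ≤ 1) {δ : ℝ} (hδ : 0 ≤ δ) (hδ' : S.card * δ ≤ 2)
    (h : 1 - δ ≤ ‖avgOp S v‖) : ‖shiftOp s v - v‖ ^ 2 ≤ 4 * (S.card * δ) := by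
  classical
  have hone : shiftOp (1 : H) v = v := by
    ext γ
    rw [shiftOp_apply, inv_one, shift_one]
  rcases eq_or_ne s 1 with rfl | hne
  · rw [hone, sub_self, norm_zero, zero_pow two_ne_zero]
    positivity
  have hs' : s ∈ S.erase 1 := Finset.mem_erase.2 ⟨hne, hs⟩
  have hcard : (((S.erase 1).erase s).card : ℝ) = S.card - 2 := by
    have h₁ := Finset.card_erase_add_one hs'
    have h₂ := Finset.card_erase_add_one h1
    rw [← h₂, ← h₁]
    push_cast
    ring
  have hsum : ∑ h ∈ S, shiftOp h v
      = (shiftOp s v + v) + ∑ h ∈ (S.erase 1).erase s, shiftOp h v := by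
    rw [← Finset.add_sum_erase _ _ h1, ← Finset.add_sum_erase _ _ hs', hone]
    abel
  have hnorm : S.card * ‖avgOp S v‖ ≤ ‖shiftOp s v + v‖ + (S.card - 2) := by
    calc S.card * ‖avgOp S v‖ = ‖(S.card : ℂ) • avgOp S v‖ := by
          rw [norm_smul, Complex.norm_natCast]
      _ ≤ ‖shiftOp s v + v‖ + ((S.erase 1).erase s).card * ‖v‖ := by
          rw [card_smul_avgOp ⟨1, h1⟩, hsum]
          exact (norm_add_le _ _).trans (by gcongr; exact norm_sum_shiftOp_le _ _)
      _ ≤ ‖shiftOp s v + v‖ + ((S.erase 1).erase s).card * 1 := by gcongr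
      _ = _ := by rw [mul_one, hcard]
  have hlow : 2 - S.card * δ ≤ ‖shiftOp s v + v‖ := by
    have : (S.card : ℝ) * (1 - δ) ≤ S.card * ‖avgOp S v‖ := by gcongr
    linarith
  have hpar := parallelogram_law_with_norm ℂ (shiftOp s v) v
  rw [norm_shiftOp] at hpar
  have h₁ : ‖v‖ ^ 2 ≤ 1 := pow_le_one₀ (norm_nonneg _) hv
  -- Squaring the lower bound needs $2-|S|\delta\ge 0$, which is the hypothesis `hδ'`.
  have h₂ : (2 - S.card * δ) ^ 2 ≤ ‖shiftOp s v + v‖ ^ 2 :=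
    pow_le_pow_left₀ (by linarith) hlow 2
  nlinarith [sq_nonneg (S.card * δ)]

theorem norm_sub_redProj_le (v : Ell2 (Bundle H)) : ‖v - redProj (V H) v‖ ≤ ‖v‖ := by
  have h : ‖(1 : Ell2 (Bundle H) →L[ℂ] Ell2 (Bundle H)) - redProj (V H)‖ ≤ 1 :=
    redProj_isStarProjection.one_sub.norm_le
  exact (((1 : Ell2 (Bundle H) →L[ℂ] Ell2 (Bundle H)) - redProj (V H)).le_of_opNorm_le h v).trans_eq
    (one_mul _)

/-- A vector that almost attains the norm of $T-P$ is projected away from $V$; its translates must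
then nearly agree. -/
theorem exists_almost_invariant
    (hgap : ∀ S : Finset H, S.Nonempty → 1 ≤ ‖avgOp S - redProj (V H)‖) (S : Finset H)
    {ε : ℝ} (hε : 0 < ε) (hε' : ε ≤ 1) : ∃ v : Ell2 (Bundle H), ‖v‖ ≤ 1 ∧ 1 - ε ≤ ‖v‖ ^ 2 ∧
      (∀ γ, src γ ∈ V H → v γ = 0) ∧ ∀ s ∈ S, ‖shiftOp s v - v‖ ≤ ε := by
  classical
  -- With $1$ among the averaged elements, the translates are compared with the vector itself.
  set S' := insert 1 S
  have hne : S'.Nonempty := ⟨1, Finset.mem_insert_self _ _⟩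
  have hc : (1 : ℝ) ≤ S'.card := Nat.one_le_cast.2 hne.card_pos
  -- Chosen so that the convexity bound $4|S'|\delta$ equals $\varepsilon^2$; then also
  -- $(1-\delta)^2\ge 1-2\delta\ge 1-\varepsilon$.
  set δ : ℝ := ε ^ 2 / (4 * S'.card) with hδ
  have hδ0 : 0 < δ := by positivity
  have hcδ : S'.card * δ = ε ^ 2 / 4 := by rw [hδ]; field_simp
  have hδε : δ ≤ ε ^ 2 / 4 := by nlinarith
  have hε2 : ε ^ 2 ≤ ε := by nlinarith
  obtain ⟨ξ, hξ, hξ'⟩ := ContinuousLinearMap.exists_lt_apply_of_lt_opNorm _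
    ((sub_lt_self 1 hδ0).trans_le (hgap S' hne))
  set v := ξ - redProj (V H) ξ
  -- Since $TP=P$, one has $(T-P)\xi=T(\xi-P\xi)$.
  have hv : (avgOp S' - redProj (V H)) ξ = avgOp S' v := by
    have := DFunLike.congr_fun (avgOp_mul_redProj hne) ξ
    change avgOp S' (redProj (V H) ξ) = _ at this
    rw [map_sub, this]
    rfl
  rw [hv] at hξ'
  have hv1 : ‖v‖ ≤ 1 := (norm_sub_redProj_le ξ).trans hξ.le
  refine ⟨v, hv1, ?_, fun γ hγ => ?_, fun s hs => ?_⟩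
  -- The average is a contraction, so $\|v\|\ge\|Tv\|>1-\delta$.
  · have h₁ : ‖avgOp S' v‖ ≤ ‖v‖ := by
      refine le_of_mul_le_mul_left ?_ (zero_lt_one.trans_le hc)
      rw [← Complex.norm_natCast, ← norm_smul, card_smul_avgOp hne, Complex.norm_natCast]
      exact norm_sum_shiftOp_le _ _
    nlinarith [norm_nonneg v]
  · change ξ γ - redProj (V H) ξ γ = 0
    rw [redProj_apply _ ⟨hγ, hγ⟩, sub_self]
  · refine (pow_le_pow_iff_left₀ (norm_nonneg _) hε.le two_ne_zero).1 ?_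
    have := norm_shiftOp_sub_sq_le (Finset.mem_insert_self _ _) (Finset.mem_insert_of_mem hs)
      hv1 hδ0.le (by rw [hcδ]; nlinarith) hξ'.le
    rw [hcδ] at this
    linarith

/-- Each vector distributes its squared norm over $H$ by the $H$-component of the arrows over $F$.
These are finitely additive measures of total mass almost one and almost invariant, and a limit
along an ultrafilter is an invariant mean. -/
theorem isAmenable_of_almost_invariant
    (h : ∀ (S : Finset H) (ε : ℝ), 0 < ε → ε ≤ 1 → ∃ v : Ell2 (Bundle H), ‖v‖ ≤ 1 ∧
      1 - ε ≤ ‖v‖ ^ 2 ∧ (∀ γ, src γ ∈ V H → v γ = 0) ∧ ∀ s ∈ S, ‖shiftOp s v - v‖ ≤ ε) :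
    IsAmenable H := by
  classical
  have hpos : ∀ n : ℕ, (0 : ℝ) < 1 / (n + 1) := fun n => Nat.one_div_pos_of_nat
  choose v hv1 hv2 hv3 hv4 using fun p : ℕ × Finset H => h p.2 (1 / (p.1 + 1)) (hpos _)
    (by rw [div_le_one (by positivity)]; simp)
  -- Refining `atTop` on the product order makes the error $1/(n+1)$ tend to zero and puts each
  -- given group element eventually into the finite set.
  let 𝒰 : Ultrafilter (ℕ × Finset H) := Ultrafilter.of atTop
  have h𝒰 : (𝒰 : Filter (ℕ × Finset H)) ≤ atTop := Ultrafilter.of_le _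
  have hfst : Tendsto (fun p : ℕ × Finset H => 1 / ((p.1 : ℝ) + 1)) 𝒰 (𝓝 0) :=
    (tendsto_one_div_add_atTop_nhds_zero_nat.comp
      (tendsto_fst.mono_left prod_atTop_atTop_eq.ge)).mono_left h𝒰
  have hmem : ∀ A p, mass (overF A) (v p) ∈ Set.Icc (0 : ℝ) 1 := fun A p =>
    ⟨mass_nonneg _ _, (mass_le _ _).trans (pow_le_one₀ (norm_nonneg _) (hv1 p))⟩
  have hex : ∀ A : Set H, ∃ m, Tendsto (fun p => mass (overF A) (v p)) 𝒰 (𝓝 m) := fun A => by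
    -- All masses lie in the compact interval $[0,1]$, so the limit exists for every subset.
    obtain ⟨m, -, hm⟩ := (isCompact_Icc (a := (0 : ℝ)) (b := 1)).ultrafilter_le_nhds
      (𝒰.map fun p => mass (overF A) (v p))
      (le_principal_iff.2 (Filter.mem_map.2 (univ_mem' (hmem A))))
    exact ⟨m, hm⟩
  choose m hm using hex
  refine ⟨m, fun A => ?_, ?_, fun A B hAB => ?_, fun k A => ?_⟩
  · exact ge_of_tendsto (hm A) (Eventually.of_forall fun p => (hmem A p).1)
  · refine tendsto_nhds_unique (hm Set.univ) ?_
    have hlow : Tendsto (fun p : ℕ × Finset H => 1 - 1 / ((p.1 : ℝ) + 1)) 𝒰 (𝓝 1) := by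
      simpa using hfst.const_sub 1
    refine tendsto_of_tendsto_of_tendsto_of_le_of_le hlow tendsto_const_nhds (fun p => ?_)
      fun p => (hmem Set.univ p).2
    -- The vector vanishes over $V$, so none of its norm is lost.
    have : mass (overF Set.univ) (v p) = ‖v p‖ ^ 2 := mass_eq_norm_sq fun γ hγ =>
      hv3 p γ (src_mem_V_of_notMem_overF hγ)
    change 1 - _ ≤ mass _ _
    rw [this]
    exact hv2 p
  · refine tendsto_nhds_unique (hm _) (((hm A).add (hm B)).congr fun p => ?_)
    rw [overF_union, mass_union (disjoint_overF hAB)]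
  · refine tendsto_nhds_unique (hm _) ?_
    simp only [mass_overF_smul]
    have hdiff : Tendsto (fun p => mass (overF A) (shiftOp k⁻¹ (v p)) - mass (overF A) (v p)) 𝒰
        (𝓝 0) := by
      -- The factor two bounds the sum of the norms of the vector and of its translate.
      have h0 : Tendsto (fun p : ℕ × Finset H => 1 / ((p.1 : ℝ) + 1) * 2) 𝒰 (𝓝 0) := by
        simpa using hfst.mul_const 2
      refine squeeze_zero_norm' ?_ h0
      -- The element needed is $k^{-1}$, because the mass of $kA$ is the mass of $A$ for the vector
      -- translated by $k^{-1}$.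
      have hk : ∀ᶠ p : ℕ × Finset H in 𝒰, k⁻¹ ∈ p.2 := by
        refine h𝒰 ?_
        filter_upwards [eventually_ge_atTop ((0, {k⁻¹}) : ℕ × Finset H)] with p hp
        exact hp.2 (Finset.mem_singleton_self _)
      filter_upwards [hk] with p hp
      refine (abs_mass_sub_le _ _ _).trans ?_
      rw [norm_shiftOp]
      exact mul_le_mul (hv4 p _ hp) (by linarith [hv1 p]) (by positivity) (hpos _).le
    simpa using hdiff.add (hm A)

/-- Were $P$ outside the algebra, no average could satisfy $\|T-P\|<1$, and the resulting almost
invariant vectors would make $H$ amenable. -/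
theorem redProj_mem (hH : ¬ IsAmenable H) : redProj (V H) ∈ redCStar (Bundle H) := by
  by_contra hmem
  refine hH (isAmenable_of_almost_invariant fun S ε hε hε' =>
    exists_almost_invariant (fun S hS => ?_) S hε hε')
  by_contra! hlt
  exact hmem (redProj_mem_of_norm_lt hS hlt)

end Bundle

end BundleExample

end

/-! ### Failure of exactness. -/

open KTheory GroupoidCStar BundleExample BundleExample.Bundle in
theorem mainTheorem4 {H : Type*} [Group H] (hH : ¬ BundleExample.IsAmenable H) :
    ¬ Function.Exact (KTheory.K₀.map (BundleExample.Bundle.inclV H))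
        (KTheory.K₀.map (BundleExample.Bundle.restrF H)) ∧
    ¬ Function.Exact (KTheory.K₀.map (BundleExample.Bundle.inclVEss H))
        (KTheory.K₀.map (BundleExample.Bundle.restrFEss H)) ∧
    ∃ (χ : GroupoidCStar.redCStar (BundleExample.Bundle H)) (hχ : IsStarProjection χ),
      GroupoidCStar.evalFun χ = Set.indicator (BundleExample.Bundle.V H) 1 ∧
      (KTheory.K₀.map (BundleExample.Bundle.restrF H) (KTheory.K₀.mk χ hχ) = 0 ∧
        KTheory.K₀.mk χ hχ ∉ Set.range (KTheory.K₀.map (BundleExample.Bundle.inclV H))) ∧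
      (KTheory.K₀.map (BundleExample.Bundle.restrFEss H)
          (KTheory.K₀.mk ((GroupoidCStar.singularIdeal (BundleExample.Bundle H)).quotHom χ)
            (StarIdeal.quotHom_isStarProjection _ hχ)) = 0 ∧
        KTheory.K₀.mk ((GroupoidCStar.singularIdeal (BundleExample.Bundle H)).quotHom χ)
            (StarIdeal.quotHom_isStarProjection _ hχ) ∉
          Set.range (KTheory.K₀.map (BundleExample.Bundle.inclVEss H))) := by
  have hmem := redProj_mem hH
  let χ : redCStar (BundleExample.Bundle H) := ⟨redProj (V H), hmem⟩
  have hχ : IsStarProjection χ :=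
    ⟨Subtype.ext redProj_isStarProjection.1, Subtype.ext redProj_isStarProjection.2⟩
  have hχ₀ : restrF H χ = 0 := restrF_redProj hmem
  have hχ₁ : ∀ i, evalX i 0 χ = 1 := fun i =>
    (congrFun (evalFun_redProj hmem) (x i 0)).trans
      (Set.indicator_of_mem (show x i 0 ∈ V H from Or.inl ⟨i, 0, rfl⟩) _)
  have h₁ := K₀.map_mk_eq_zero (restrF H) hχ hχ₀
  have h₂ := K₀.mk_notMem_range (inclV H) hχ (fun i => evalX i 0) hχ₁ tendsto_evalX_inclV
  -- The reduced facts `hχ₀` and, below, `hχ₁` apply unchanged, since the maps on the quotient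
  -- evaluate on the class of `χ` as the original ones do on `χ`.
  have h₃ := K₀.map_mk_eq_zero (restrFEss H)
    (StarIdeal.quotHom_isStarProjection (singularIdeal (BundleExample.Bundle H)) hχ) hχ₀
  have h₄ := K₀.mk_notMem_range (inclVEss H)
    (StarIdeal.quotHom_isStarProjection (singularIdeal (BundleExample.Bundle H)) hχ)
    (fun i => evalXEss i 0) hχ₁ tendsto_evalXEss_inclVEss
  exact ⟨fun h => h₂ ((h _).1 h₁), fun h => h₄ ((h _).1 h₃), χ, hχ, evalFun_redProj hmem,
    ⟨h₁, h₂⟩, h₃, h₄⟩
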